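/- **Setting.** Let $\mathbf{T}^2=\mathbf{R}^2/\mathbf{Z}^2$. Let $\rho\in\mathcal{C}^\infty(\mathbf{R}^2)$ be nonnegative and even, with $\operatorname{supp}\rho\subset(-\frac12,\frac12)^2$ and $\|\rho\|_{L^1}=1$. For $\varepsilon\in(0,1)$ let $\rho^\varepsilon(x)=\varepsilon^{-2}\rho(\varepsilon^{-1}x)$, regarded as a function on $\mathbf{T}^2$ by periodic extension, and let $R^\varepsilon=\rho^\varepsilon*\rho^\varepsilon$ (convolution on $\mathbf{T}^2$). For $t\ge 0$ and paths $X,Y\in\mathcal{C}([0,t];\mathbf{T}^2)$ define the intersection time $$\mathscr{I}^\varepsilon_t[X,Y]=\int_0^tR^\varepsilon(X(s)-Y(s))\,\mathrm{d}s .$$ Let $W$ be a standard space-time white noise on $[0,t]\times\mathbf{T}^2$, defined on a probability space with expectation $\mathbf{E}$ (its Wiener integrals being taken in a jointly measurable version). For $x\in\mathbf{T}^2$ let $\mathbb{P}_{X^{t,x}}$, with expectation $\mathbb{E}_{X^{t,x}}$, be the law on $\mathcal{C}([0,t];\mathbf{T}^2)$ of a standard Brownian motion $X$ on $\mathbf{T}^2$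 running backwards in time with $X(t)=x$. For $\theta\ge 0$ let $$\mathscr{E}[W,X]=\exp\Big\{\theta^{\frac12}|\log\varepsilon|^{-\frac12}\int_0^t\!\!\int_{\mathbf{T}^2}\rho^\varepsilon(X(s)-y)\,W(\mathrm{d}y\,\mathrm{d}s)-|\log\varepsilon|^{-\frac12}\kappa\Big\},$$ where $\kappa=\kappa^\varepsilon_\theta(t)$ is the deterministic constant $$\kappa=|\log\varepsilon|^{\frac12}\,\mathbf{E}\log\mathbb{E}_{X^{t,x}}\exp\Big\{\theta^{\frac12}|\log\varepsilon|^{-\frac12}\int_0^t\!\!\int_{\mathbf{T}^2}\rho^\varepsilon(X(s)-y)\,W(\mathrm{d}y\,\mathrm{d}s)\Big\}.$$ Let $\widehat{\mathbb{P}}^{\theta,W,\varepsilon}_{X^{t,x}}$ be the (random) tilted probability measure with density $\mathscr{E}[W,X]/\mathbb{E}_{X^{t,x}}\mathscr{E}[W,X]$ with respect to $\mathbb{P}_{X^{t,x}}$. Let $J\ge 0$ be an integer and $\mathbf{x}=(x_1,\dots,x_J)\in(\mathbf{T}^2)^J$. Let $\underline{\mathbf{X}}=(\mathbf{X}_0,\mathbf{X}_1,\mathbf{X}_2)$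 with $\mathbf{X}_\alpha=(X_{\alpha;1},\dots,X_{\alpha;J})$, and let $\widehat{\mathbb{E}}^{\theta,W,\varepsilon}_{\underline{\mathbf{X}}}$ denote expectation under the product measure for which the $3J$ paths $X_{\alpha;j}$ are independent and $X_{\alpha;j}$ has law $\widehat{\mathbb{P}}^{\theta,W,\varepsilon}_{X^{t,x_j}}$. For measurable $\mathscr{Q}:\mathcal{C}([0,t];\mathbf{T}^2)^J\to\mathbf{R}$ with $\mathscr{Q}$ integrable under $\mathbb{P}_{X^{t,x_1}}\otimes\dots\otimes\mathbb{P}_{X^{t,x_J}}$, and for real $r\ge0$, $\theta\ge0$, set $$G_{r,\mathscr{Q}}(\theta)=|\log\varepsilon|^{-r}\sum_{\alpha,\beta=0}^{2}\ \sum_{j,k=1}^{J}\mathbf{1}_{(\alpha,j)\neq(\beta,k)}\ \mathbf{E}\,\widehat{\mathbb{E}}^{\theta,W,\varepsilon}_{\underline{\mathbf{X}}}\big(\mathscr{Q}[\mathbf{X}_0]\,\mathscr{I}^\varepsilon_t[X_{\alpha;j},X_{\beta;k}]^{r}\big)$$ (with $0^0=1$), and let $|\mathscr{Q}|[\mathbf{X}_0]=|\mathscr{Q}[\mathbf{X}_0]|$.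 **Claim.** For every $J$ there is a constant $C(J)>0$, depending only on $J$ (and not on $\rho,\varepsilon,t,\mathbf{x},\mathscr{Q},r,\theta$ or the underlying probability space), such that for all $r\ge0$ and $\theta\ge0$ the following hold. 1. For every measurable $\mathscr{Q}$ that is integrable as above, $G_{r,\mathscr{Q}}$ is differentiable at $\theta$ as a function on $[0,\infty)$ (one-sidedly at $\theta=0$), and $$|G'_{r,\mathscr{Q}}(\theta)|\le C(J)\,G_{r+1,|\mathscr{Q}|}(\theta).$$ 2. For every bounded measurable $\mathscr{Q}$, the following series converges and $$G_{r,\mathscr{Q}}(\theta)\le\sum_{j=0}^{\infty}\frac{(C(J)\theta)^j}{j!}\,G_{r+j,|\mathscr{Q}|}(0).$$ -/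

import Mathlib

open MeasureTheory ProbabilityTheory Set
open scoped NNReal ENNReal

noncomputable section

namespace KPZ

/-- The two-dimensional torus `ℝ² / ℤ²`; its `volume` is Lebesgue measure, of total mass one. -/
abbrev Torus : Type := UnitAddTorus (Fin 2)

/-- A mollifier on `ℝ²`: a smooth, nonnegative, even function with integral one whose support
lies in the open square `(-1/2, 1/2)²`. -/
structure Mollifier where
  toFun : (Fin 2 → ℝ) → ℝ
  smooth : ContDiff ℝ ((⊤ : ℕ∞) : WithTop ℕ∞) toFun
  nonneg : ∀ x, 0 ≤ toFun x
  even : ∀ x, toFun (-x) = toFun x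
  support_subset : tsupport toFun ⊆ {x | ∀ i, x i ∈ Ioo (-1 / 2 : ℝ) (1 / 2)}
  integral_eq_one : ∫ x, toFun x = 1

/-- The representative in `[-1/2, 1/2)²` of a point of the torus. -/
def rep (z : Torus) : Fin 2 → ℝ :=
  fun i => (AddCircle.equivIco (1 : ℝ) (-1 / 2) (z i) : ℝ)

lemma measurable_rep : Measurable rep := by
  refine measurable_pi_lambda _ fun i => ?_
  exact measurable_subtype_coe.comp
    ((AddCircle.measurableEquivIco (1 : ℝ) (-1 / 2)).measurable.comp (measurable_pi_apply i))

/-- `ρ^ε(x) = ε⁻² ρ(ε⁻¹ x)`, extended periodically, as a function on the torus. For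
`0 < ε < 1` the support of `ρ^ε` lies in `(-1/2, 1/2)²`, so the periodic extension is the
value at the representative in `[-1/2, 1/2)²`. -/
def mollTorus (ρ : Mollifier) (ε : ℝ) (z : Torus) : ℝ :=
  (ε ^ 2)⁻¹ * ρ.toFun (ε⁻¹ • rep z)

lemma measurable_mollTorus (ρ : Mollifier) (ε : ℝ) : Measurable (mollTorus ρ ε) :=
  (ρ.smooth.continuous.measurable.comp (measurable_rep.const_smul ε⁻¹)).const_mul _

lemma mollTorus_bounded (ρ : Mollifier) (ε : ℝ) : ∃ M, ∀ z, ‖mollTorus ρ ε z‖ ≤ M := by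
  have hc : HasCompactSupport ρ.toFun := by
    refine IsCompact.of_isClosed_subset
      (isCompact_univ_pi fun _ : Fin 2 => isCompact_Icc (a := (-1 / 2 : ℝ)) (b := 1 / 2))
      (isClosed_tsupport _) fun x hx i _ => Ioo_subset_Icc_self (ρ.support_subset hx i)
  obtain ⟨M, hM⟩ := hc.exists_bound_of_continuous ρ.smooth.continuous
  refine ⟨‖(ε ^ 2)⁻¹‖ * M, fun z => ?_⟩
  rw [mollTorus, norm_mul]
  exact mul_le_mul_of_nonneg_left (hM _) (norm_nonneg _)

/-- The torus convolution `R^ε = ρ^ε * ρ^ε`. -/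
def R (ρ : Mollifier) (ε : ℝ) (z : Torus) : ℝ :=
  ∫ y : Torus, mollTorus ρ ε y * mollTorus ρ ε (z - y)

/-- Continuous paths `[0,t] → 𝕋²`, with the Borel σ-algebra of uniform convergence. -/
abbrev Path (t : ℝ≥0) : Type := C(Icc (0 : ℝ) t, Torus)

instance (t : ℝ≥0) : MeasurableSpace (Path t) := borel _

instance (t : ℝ≥0) : BorelSpace (Path t) := ⟨rfl⟩

/-- Lebesgue measure on the time interval `[0,t]`. -/
def timeMeasure (t : ℝ≥0) : Measure (Icc (0 : ℝ) t) := volume.comap Subtype.val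

instance (t : ℝ≥0) : IsFiniteMeasure (timeMeasure t) := by
  refine ⟨?_⟩
  rw [timeMeasure, comap_subtype_coe_apply measurableSet_Icc]
  exact (measure_mono (Subtype.coe_image_subset _ _)).trans_lt measure_Icc_lt_top

/-- The intersection time `𝓘_t^ε[X, Y] = ∫₀ᵗ R^ε(X(s) - Y(s)) ds`. -/
def intersectionTime (ρ : Mollifier) (ε : ℝ) {t : ℝ≥0} (X Y : Path t) : ℝ :=
  ∫ s, R ρ ε (X s - Y s) ∂(timeMeasure t)

/-- The law at time `v` of standard Brownian motion on the torus started at the origin: the image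
in the torus of the centered Gaussian law on `ℝ²` with covariance `v • 1`. -/
def heatLaw (v : ℝ≥0) : Measure Torus :=
  (Measure.pi fun _ : Fin 2 => gaussianReal 0 v).map fun y i => (y i : UnitAddCircle)

/-- `P` is the law on path space of standard Brownian motion on the torus running backwards in
time from the position `x` at time `t`. -/
structure IsBackwardBrownianLaw (t : ℝ≥0) (x : Torus) (P : Measure (Path t)) : Prop where
  isProbabilityMeasure : IsProbabilityMeasure P
  start : ∀ᵐ X ∂P, X ⟨t, t.2, le_rfl⟩ = x
  indep : HasIndepIncrements (fun (s : Icc (0 : ℝ) t) (X : Path t) => X s) P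
  law : ∀ s u : Icc (0 : ℝ) t, s ≤ u →
    P.map (fun X => X s - X u) = heatLaw (Real.toNNReal ((u : ℝ) - s))

/-- The Hilbert space `L²([0,t] × 𝕋²)` of integrands. -/
abbrev NoiseSpace (t : ℝ≥0) : Type :=
  Lp ℝ 2 ((timeMeasure t).prod (volume : Measure Torus))

instance (t : ℝ≥0) : MeasurableSpace (NoiseSpace t) := borel _

instance (t : ℝ≥0) : BorelSpace (NoiseSpace t) := ⟨rfl⟩

/-- `W` is a standard space-time white noise on `[0,t] × 𝕋²`, given through its Wiener integrals
`W f = ∫₀ᵗ ∫ f(s,y) W(dy ds)`: a centered Gaussian family indexed by `L²([0,t] × 𝕋²)` whose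
covariance is the inner product. As usual, the family is taken in a jointly measurable
version, so that integrals over random integrands make sense. -/
structure IsWhiteNoise {Ω : Type*} [MeasurableSpace Ω] (μ : Measure Ω) {t : ℝ≥0}
    (W : NoiseSpace t → Ω → ℝ) : Prop where
  measurable : Measurable (Function.uncurry W)
  gaussian : IsGaussianProcess W μ
  mean : ∀ f, ∫ ω, W f ω ∂μ = 0
  covariance : ∀ f g, ∫ ω, W f ω * W g ω ∂μ = inner ℝ f g

lemma memLp_integrand (ρ : Mollifier) (ε : ℝ) {t : ℝ≥0} (X : Path t) :
    MemLp (fun p : Icc (0 : ℝ) t × Torus => mollTorus ρ ε (X p.1 - p.2)) 2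
      ((timeMeasure t).prod volume) := by
  obtain ⟨M, hM⟩ := mollTorus_bounded ρ ε
  refine MemLp.of_bound ?_ M (Filter.Eventually.of_forall fun p => hM _)
  refine ((measurable_mollTorus ρ ε).comp ?_).aestronglyMeasurable
  exact (X.continuous.measurable.comp measurable_fst).sub measurable_snd

/-- The integrand `(s, y) ↦ ρ^ε(X(s) - y)`, as an element of `L²([0,t] × 𝕋²)`. -/
def integrand (ρ : Mollifier) (ε : ℝ) {t : ℝ≥0} (X : Path t) : NoiseSpace t :=
  (memLp_integrand ρ ε X).toLp _

section Tilted

variable {Ω : Type*} [MeasurableSpace Ω] (μ : Measure Ω) {t : ℝ≥0} (W : NoiseSpace t → Ω → ℝ)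
  (ρ : Mollifier) (ε : ℝ)

/-- `θ^{1/2} |log ε|^{-1/2} ∫₀ᵗ ∫ ρ^ε(X(s) - y) W(dy ds)`. -/
def energy (θ : ℝ) (ω : Ω) (X : Path t) : ℝ :=
  Real.sqrt θ / Real.sqrt |Real.log ε| * W (integrand ρ ε X) ω

/-- The renormalization constant `κ_θ^ε(t) = 𝐄 h̃_θ^ε(t, x)`, where
`h̃_θ^ε(t, x) = |log ε|^{1/2} log 𝔼_{X^{t,x}} exp(energy)` and `P` is the law of `X^{t,x}`. -/
def kappa (P : Measure (Path t)) (θ : ℝ) : ℝ :=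
  ∫ ω, Real.sqrt |Real.log ε| * Real.log (∫ X, Real.exp (energy W ρ ε θ ω X) ∂P) ∂μ

/-- The tilted path measure, whose density with respect to `P` is `𝓔 / ∫ 𝓔 dP` with
`𝓔 = exp(energy - |log ε|^{-1/2} κ)`. -/
def tiltedLaw (P : Measure (Path t)) (θ : ℝ) (ω : Ω) : Measure (Path t) :=
  P.tilted fun X => energy W ρ ε θ ω X - (Real.sqrt |Real.log ε|)⁻¹ * kappa μ W ρ ε P θ

/-- `F_{α,j;β,k;r,Q}(θ)`: the expectation over the noise of the expectation of
`Q[X₀] 𝓘_t^ε[X_{α;j}, X_{β;k}]^r`, where the paths `X_{γ;l}` (`γ = 0, 1, 2`, `l = 1, …, J`) are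
independent with laws the tilted versions of `P l`. -/
def Fterm {J : ℕ} (P : Fin J → Measure (Path t)) (a b : Fin 3 × Fin J) (r : ℝ)
    (Q : (Fin J → Path t) → ℝ) (θ : ℝ) : ℝ :=
  ∫ ω, (∫ X : Fin 3 × Fin J → Path t,
      Q (fun j => X (0, j)) * intersectionTime ρ ε (X a) (X b) ^ r
    ∂(Measure.pi fun i : Fin 3 × Fin J => tiltedLaw μ W ρ ε (P i.2) θ ω)) ∂μ

/-- `F_{r,Q}(θ)`, the sum of the `F_{α,j;β,k;r,Q}(θ)` over `(α,j) ≠ (β,k)`. -/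
def F {J : ℕ} (P : Fin J → Measure (Path t)) (r : ℝ) (Q : (Fin J → Path t) → ℝ) (θ : ℝ) : ℝ :=
  ∑ α : Fin 3, ∑ β : Fin 3, ∑ j : Fin J, ∑ k : Fin J,
    if (α, j) ≠ (β, k) then Fterm μ W ρ ε P (α, j) (β, k) r Q θ else 0

/-- `G_{r,Q}(θ) = |log ε|^{-r} F_{r,Q}(θ)`. -/
def G {J : ℕ} (P : Fin J → Measure (Path t)) (r : ℝ) (Q : (Fin J → Path t) → ℝ) (θ : ℝ) : ℝ :=
  |Real.log ε| ^ (-r) * F μ W ρ ε P r Q θ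

end Tilted

end KPZ

end

/-
The energies `U X = ∫ ρ^ε(X(s) - y) dW` form a Gaussian field whose covariance is the intersection
time `K`, and in the parameter `β = (θ / |log ε|)^{1/2}` the tilting is by `β U`. The `β`-derivative
of a tilted mean inserts the difference of the field at a path and at an independent replica of it.
Gaussian integration by parts turns this into `β` times a difference of covariances between three
replicas of the system of paths. The variance `K X X` is constant, so the diagonal terms cancel; the
surviving overlaps are absorbed through `a^r b ≤ a^{r+1} + b^{r+1}`, and as each of them meets only
three layers of paths it is, up to relabelling, a term of the same sum with exponent `r + 1`. Since
`d(β²) = 2 β dβ`, this is `|G_r'| ≤ C G_{r+1}`. Overlaps are bounded, so `G_r` grows at most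
geometrically in `r` and the iterated inequality has a vanishing Taylor remainder.
-/

noncomputable section

namespace KPZ

section RandomIntegral

variable {T Ω Ω' E : Type*} [MeasurableSpace T] [MeasurableSpace Ω] [MeasurableSpace Ω']
  [NormedAddCommGroup E] [NormedSpace ℝ E] [SecondCountableTopology E]
  [MeasurableSpace E] [BorelSpace E] {μ : Measure Ω} {μ' : Measure Ω'}
  {P : Measure T} [IsProbabilityMeasure P] {A : T → Ω → E} {A' : T → Ω' → E}

lemma measurable_integral_of_uncurry (hA : Measurable (Function.uncurry A)) :
    Measurable fun ω => ∫ y, A y ω ∂P :=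
  hA.stronglyMeasurable.integral_prod_left.measurable

variable [CompleteSpace E]

lemma ae_tendsto_average_infinitePi {f : T → E} (hf : Measurable f) (hi : Integrable f P) :
    ∀ᵐ y ∂(Measure.infinitePi fun _ : ℕ => P),
      Filter.Tendsto (fun n : ℕ => (n : ℝ)⁻¹ • ∑ i ∈ Finset.range n, f (y i)) Filter.atTop
        (nhds (∫ x, f x ∂P)) := by
  have hmp := fun i : ℕ => measurePreserving_eval_infinitePi (fun _ : ℕ => P) i
  have key := strong_law_ae (μ := Measure.infinitePi fun _ : ℕ => P) (fun i y => f (y i))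
    ((hmp 0).integrable_comp_of_integrable hi)
    (fun i j hij => (iIndepFun_infinitePi fun _ => hf).indepFun hij)
    (fun i => IdentDistrib.comp ⟨(hmp i).measurable.aemeasurable, (hmp 0).measurable.aemeasurable,
      (hmp i).map_eq.trans (hmp 0).map_eq.symm⟩ hf)
  rwa [show ∫ y, f (y 0) ∂(Measure.infinitePi fun _ : ℕ => P) = ∫ x, f x ∂P from
    (hmp 0).hasLaw.integral_comp hf.aestronglyMeasurable] at key

lemma ae_ae_tendsto_average [SFinite μ] (hA : Measurable (Function.uncurry A))
    (hi : ∀ᵐ ω ∂μ, Integrable (fun y => A y ω) P) :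
    ∀ᵐ y ∂(Measure.infinitePi fun _ : ℕ => P), ∀ᵐ ω ∂μ,
      Filter.Tendsto (fun n : ℕ => (n : ℝ)⁻¹ • ∑ i ∈ Finset.range n, A (y i) ω) Filter.atTop
        (nhds (∫ x, A x ω ∂P)) := by
  have hmeas : MeasurableSet {p : Ω × (ℕ → T) |
      Filter.Tendsto (fun n : ℕ => (n : ℝ)⁻¹ • ∑ i ∈ Finset.range n, A (p.2 i) p.1) Filter.atTop
        (nhds (∫ x, A x p.1 ∂P))} := by
    refine measurableSet_tendsto_fun (fun n => .const_smul (Finset.measurable_fun_sum _ fun i _ =>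
      hA.comp (((measurable_pi_apply i).comp measurable_snd).prodMk measurable_fst)) _)
      ((measurable_integral_of_uncurry hA).comp measurable_fst)
  refine Measure.ae_ae_comm hmeas |>.1 ?_
  filter_upwards [hi] with ω hω
  exact ae_tendsto_average_infinitePi (hA.comp measurable_prodMk_right) hω

-- Averaging `A` along an i.i.d. sample of `P`, the strong law of large numbers writes the integral
-- as an almost sure limit of functions of countably many coordinates of the process.
theorem identDistrib_integral [IsProbabilityMeasure μ] [IsProbabilityMeasure μ']
    (hA : Measurable (Function.uncurry A)) (hA' : Measurable (Function.uncurry A'))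
    (hi : ∀ᵐ ω ∂μ, Integrable (fun y => A y ω) P)
    (hi' : ∀ᵐ ω ∂μ', Integrable (fun y => A' y ω) P)
    (h : IdentDistrib (fun ω y => A y ω) (fun ω y => A' y ω) μ μ') :
    IdentDistrib (fun ω => ∫ y, A y ω ∂P) (fun ω => ∫ y, A' y ω ∂P) μ μ' := by
  obtain ⟨y, hy, hy'⟩ := ((ae_ae_tendsto_average hA hi).and (ae_ae_tendsto_average hA' hi')).exists
  have hI := (measurable_integral_of_uncurry hA (P := P)).aemeasurable (μ := μ)
  have hI' := (measurable_integral_of_uncurry hA' (P := P)).aemeasurable (μ := μ')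
  have hsum : ∀ n : ℕ, IdentDistrib (fun ω => (n : ℝ)⁻¹ • ∑ i ∈ Finset.range n, A (y i) ω)
      (fun ω => (n : ℝ)⁻¹ • ∑ i ∈ Finset.range n, A' (y i) ω) μ μ' := fun n =>
    h.comp (u := fun f : T → E => (n : ℝ)⁻¹ • ∑ i ∈ Finset.range n, f (y i))
      (Measurable.const_smul (Finset.measurable_fun_sum _ fun i _ => measurable_pi_apply (y i)) _)
  have hlim := tendstoInDistribution_of_ae_tendsto (fun n => (hsum n).aemeasurable_fst) hI hy
  have hlim' := tendstoInDistribution_of_ae_tendsto (fun n => (hsum n).aemeasurable_snd) hI' hy'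
  refine ⟨hI, hI', ?_⟩
  refine tendstoInDistribution_unique
    (fun (n : ℕ) ω => (n : ℝ)⁻¹ • ∑ i ∈ Finset.range n, A (y i) ω) hlim
    ⟨hlim.forall_aemeasurable, hI', ?_⟩
  exact hlim'.tendsto.congr fun n => Subtype.ext (hsum n).map_eq.symm

end RandomIntegral

section Tilting

variable {T : Type*} [MeasurableSpace T] {P : Measure T} {u : T → ℝ} {β c : ℝ}

/-- The density of the exponential tilting `P.tilted e` with respect to `P`. -/
def tiltedDensity (P : Measure T) (e : T → ℝ) (x : T) : ℝ :=
  Real.exp (e x) / ∫ y, Real.exp (e y) ∂P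

lemma tiltedDensity_nonneg (e : T → ℝ) (x : T) : 0 ≤ tiltedDensity P e x := by
  unfold tiltedDensity; positivity

lemma integral_tilted_eq_tiltedDensity (e B : T → ℝ) :
    ∫ x, B x ∂(P.tilted e) = ∫ x, tiltedDensity P e x * B x ∂P :=
  integral_tilted e B

lemma integral_tiltedDensity [NeZero P] {e : T → ℝ} (he : Integrable (fun y => Real.exp (e y)) P) :
    ∫ x, tiltedDensity P e x ∂P = 1 := by
  simp only [tiltedDensity, integral_div]
  exact div_self (integral_exp_pos he).ne'

lemma tiltedDensity_add {a : T → ℝ} [NeZero P] (ha : Integrable (fun y => Real.exp (a y)) P)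
    (e : T → ℝ) (x : T) :
    tiltedDensity P (fun y => a y + e y) x =
      tiltedDensity P a x * tiltedDensity (P.tilted a) e x := by
  have hpos := integral_exp_pos ha
  simp only [tiltedDensity, integral_exp_tilted, Pi.add_apply, Real.exp_add]
  field_simp

lemma hasDerivAt_tiltedDensity_mul [NeZero P] {t : ℝ} (ht : t ∈ interior (integrableExpSet u P))
    (x : T) :
    HasDerivAt (fun s => tiltedDensity P (fun y => s * u y) x)
      (tiltedDensity P (fun y => t * u y) x *
        (u x - ∫ y, u y ∂(P.tilted fun y => t * u y))) t := by
  have hexp : ∀ s ∈ interior (integrableExpSet u P),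
      tiltedDensity P (fun y => s * u y) x = Real.exp (s * u x - cgf u P s) := fun s hs => by
    rw [Real.exp_sub, exp_cgf (interior_subset (s := integrableExpSet u P) hs)]; rfl
  rw [integral_tilted_mul_self ht, hexp t ht]
  refine HasDerivAt.congr_of_eventuallyEq ?_
    (Filter.eventually_of_mem (isOpen_interior.mem_nhds ht) hexp)
  simpa using (((hasDerivAt_id t).mul_const (u x)).sub
    (analyticAt_cgf ht).differentiableAt.hasDerivAt).exp

lemma hasDerivAt_tiltedDensity_add_mul [NeZero P] {a b : T → ℝ}
    (h : ∀ s : ℝ, Integrable (fun y => Real.exp (a y + s * b y)) P) (t : ℝ) (x : T) :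
    HasDerivAt (fun s => tiltedDensity P (fun y => a y + s * b y) x)
      (tiltedDensity P (fun y => a y + t * b y) x *
        (b x - ∫ y, b y ∂(P.tilted fun y => a y + t * b y))) t := by
  have ha : Integrable (fun y => Real.exp (a y)) P := by simpa using h 0
  have := isProbabilityMeasure_tilted ha
  have hset : integrableExpSet b (P.tilted a) = univ := eq_univ_of_forall fun s => by
    refine (integrable_tilted_iff ha _).2 ((h s).congr (.of_forall fun y => ?_))
    simp only [Real.exp_add, smul_eq_mul]
  have key := (hasDerivAt_tiltedDensity_mul (P := P.tilted a) (u := b) (t := t)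
    (by simp [hset]) x).const_mul (tiltedDensity P a x)
  rw [tilted_tilted ha, ← mul_assoc, ← tiltedDensity_add ha] at key
  exact key.congr_of_eventuallyEq (.of_forall fun s => tiltedDensity_add ha _ x)

/-- The exponential moment `∫ exp (C |u|) dP`. -/
def expMoment (P : Measure T) (u : T → ℝ) (C : ℝ) : ℝ := ∫ y, Real.exp (C * |u y|) ∂P

section Integrability

variable (hm : Measurable u) (hu : ∀ C : ℝ, Integrable (fun y => Real.exp (C * |u y|)) P)

include hu

lemma expMoment_mono {d : ℝ} (hcd : c ≤ d) : expMoment P u c ≤ expMoment P u d :=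
  integral_mono (hu c) (hu d) fun _ =>
    Real.exp_le_exp.2 (mul_le_mul_of_nonneg_right hcd (abs_nonneg _))

include hm

lemma integrable_of_integrable_exp_abs : Integrable u P :=
  (hu 1).mono' hm.aestronglyMeasurable (.of_forall fun y => by
    rw [one_mul, Real.norm_eq_abs]; linarith [Real.add_one_le_exp |u y|])

lemma integrable_exp_const_mul (β : ℝ) : Integrable (fun y => Real.exp (β * u y)) P :=
  (hu |β|).mono' (hm.const_mul β).exp.aestronglyMeasurable (.of_forall fun y => by
    rw [Real.norm_of_nonneg (Real.exp_pos _).le, ← abs_mul]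
    exact Real.exp_le_exp.2 (le_abs_self _))

end Integrability

variable [IsProbabilityMeasure P]

lemma abs_integral_tilted_le {b : T → ℝ} {M : ℝ} (hbM : ∀ y, |b y| ≤ M) (e : T → ℝ) :
    |∫ y, b y ∂(P.tilted e)| ≤ M := by
  obtain ⟨y⟩ := P.nonempty_of_neZero
  refine (norm_integral_le_of_norm_le_const (f := b) (.of_forall hbM)).trans ?_
  exact mul_le_of_le_one_right ((abs_nonneg _).trans (hbM y)) measureReal_le_one

lemma exp_integral_le_integral_exp {f : T → ℝ} (hf : Integrable f P)
    (hi : Integrable (fun y => Real.exp (f y)) P) :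
    Real.exp (∫ y, f y ∂P) ≤ ∫ y, Real.exp (f y) ∂P :=
  convexOn_exp.map_integral_le Real.continuous_exp.continuousOn isClosed_univ
    (.of_forall fun _ => mem_univ _) hf hi

lemma inv_integral_exp_le (hu : Integrable u P) (h : Integrable (fun y => Real.exp (u y)) P)
    (h' : Integrable (fun y => Real.exp (-u y)) P) :
    (∫ y, Real.exp (u y) ∂P)⁻¹ ≤ ∫ y, Real.exp (-u y) ∂P := by
  calc (∫ y, Real.exp (u y) ∂P)⁻¹ ≤ (Real.exp (∫ y, u y ∂P))⁻¹ :=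
        inv_anti₀ (Real.exp_pos _) (exp_integral_le_integral_exp hu h)
    _ = Real.exp (∫ y, -u y ∂P) := by rw [integral_neg, Real.exp_neg]
    _ ≤ _ := exp_integral_le_integral_exp hu.neg h'

section Bounds

variable (hm : Measurable u) (hu : ∀ C : ℝ, Integrable (fun y => Real.exp (C * |u y|)) P)

include hu

lemma one_le_expMoment (hc : 0 ≤ c) : 1 ≤ expMoment P u c := by
  simpa [expMoment] using integral_mono (μ := P) (integrable_const (1 : ℝ)) (hu c)
    fun y => Real.one_le_exp (by positivity)

lemma expMoment_pow_le (n : ℕ) : expMoment P u c ^ n ≤ expMoment P u (n * c) := by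
  have hpow : ∀ y, Real.exp (c * |u y|) ^ n = Real.exp (n * c * |u y|) := fun y => by
    rw [← Real.exp_nat_mul, mul_assoc]
  have hjensen := (convexOn_pow n).map_integral_le (μ := P) (f := fun y => Real.exp (c * |u y|))
    (continuous_pow n).continuousOn isClosed_Ici
    (.of_forall fun y => (Real.exp_pos _).le) (hu c)
    ((hu (n * c)).congr (.of_forall fun y => (hpow y).symm))
  simpa only [expMoment, Function.comp_def, hpow] using hjensen

include hm

lemma tiltedDensity_le (hβ : |β| ≤ c) (x : T) :
    tiltedDensity P (fun y => β * u y) x ≤ Real.exp (c * |u x|) * expMoment P u c := by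
  have hneg : ∀ y, Real.exp (-(β * u y)) = Real.exp (-β * u y) := fun y => by rw [neg_mul]
  have hle : ∀ b : ℝ, |b| ≤ c → ∀ y, Real.exp (b * u y) ≤ Real.exp (c * |u y|) := fun b hb y =>
    Real.exp_le_exp.2 ((le_abs_self _).trans (by rw [abs_mul]; gcongr))
  have hinv := inv_integral_exp_le ((integrable_of_integrable_exp_abs hm hu).const_mul β)
    (integrable_exp_const_mul hm hu β)
    (by simpa only [hneg] using integrable_exp_const_mul hm hu (-β))
  rw [tiltedDensity, div_eq_mul_inv]
  refine mul_le_mul (hle β hβ x) (hinv.trans ?_) (by positivity) (Real.exp_pos _).le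
  simp only [hneg]
  exact integral_mono (integrable_exp_const_mul hm hu (-β)) (hu c) (hle _ (by rwa [abs_neg]))

lemma tiltedDensity_sq_le (hβ : |β| ≤ c) (x : T) :
    tiltedDensity P (fun y => β * u y) x ^ 2 ≤
      Real.exp (4 * c * |u x|) + expMoment P u (4 * c) := by
  have hpow := expMoment_pow_le hu (c := c) 4
  have hexp : Real.exp (4 * c * |u x|) = Real.exp (c * |u x|) ^ 4 := by
    rw [← Real.exp_nat_mul, mul_assoc]; norm_num
  calc tiltedDensity P (fun y => β * u y) x ^ 2
      ≤ (Real.exp (c * |u x|) * expMoment P u c) ^ 2 :=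
        pow_le_pow_left₀ (tiltedDensity_nonneg _ _) (tiltedDensity_le hm hu hβ x) 2
    _ ≤ Real.exp (c * |u x|) ^ 4 + expMoment P u c ^ 4 := by
        nlinarith [sq_nonneg (Real.exp (c * |u x|) ^ 2 - expMoment P u c ^ 2),
          sq_nonneg (Real.exp (c * |u x|) ^ 2), sq_nonneg (expMoment P u c ^ 2)]
    _ ≤ _ := by rw [hexp]; exact add_le_add_right (by exact_mod_cast hpow) _

lemma tiltedDensity_le_add (hβ : |β| ≤ c) (x : T) :
    tiltedDensity P (fun y => β * u y) x ≤
      Real.exp (4 * c * |u x|) + expMoment P u (4 * c) := by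
  have hc : 0 ≤ c := (abs_nonneg β).trans hβ
  have hone : 1 ≤ Real.exp (4 * c * |u x|) := Real.one_le_exp (by positivity)
  nlinarith [tiltedDensity_sq_le hm hu hβ x, one_le_expMoment hu (c := 4 * c) (by positivity),
    sq_nonneg (tiltedDensity P (fun y => β * u y) x - 1)]

lemma abs_sub_mul_tiltedDensity_le (hβ : |β| ≤ c) (x y : T) :
    |u x - u y| * (tiltedDensity P (fun z => β * u z) x * tiltedDensity P (fun z => β * u z) y) ≤
      Real.exp (4 * (c + 1) * |u x|) + Real.exp (4 * (c + 1) * |u y|) +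
        expMoment P u (4 * (c + 1)) := by
  have hc : 0 ≤ c := (abs_nonneg β).trans hβ
  set C := c + 1
  have hD : ∀ z, Real.exp (4 * C * |u z|) = Real.exp (C * |u z|) ^ 4 := fun z => by
    rw [← Real.exp_nat_mul, mul_assoc]; norm_num
  have hM : expMoment P u C ^ 4 ≤ expMoment P u (4 * C) := by
    exact_mod_cast expMoment_pow_le hu (c := C) 4
  have hM0 : 0 ≤ expMoment P u c := (zero_le_one.trans (one_le_expMoment hu hc))
  have hMC : expMoment P u c ≤ expMoment P u C := expMoment_mono hu (by linarith)
  have habs : |u x - u y| ≤ Real.exp |u x| * Real.exp |u y| := by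
    rw [← Real.exp_add]
    linarith [abs_sub (u x) (u y), Real.add_one_le_exp (|u x| + |u y|)]
  have hmul : ∀ z, Real.exp (C * |u z|) = Real.exp |u z| * Real.exp (c * |u z|) := fun z => by
    rw [← Real.exp_add]; congr 1; ring
  have hAM : ∀ a b m : ℝ, a * b * m ^ 2 ≤ a ^ 4 + b ^ 4 + m ^ 4 := fun a b m => by
    nlinarith [sq_nonneg (a * b - m ^ 2), sq_nonneg (a ^ 2 - b ^ 2), sq_nonneg (a ^ 2),
      sq_nonneg (b ^ 2), sq_nonneg (m ^ 2)]
  calc |u x - u y| * (tiltedDensity P (fun z => β * u z) x * tiltedDensity P (fun z => β * u z) y)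
      ≤ (Real.exp |u x| * Real.exp |u y|) * ((Real.exp (c * |u x|) * expMoment P u c) *
          (Real.exp (c * |u y|) * expMoment P u c)) := by
        have hden := mul_le_mul (tiltedDensity_le hm hu hβ x) (tiltedDensity_le hm hu hβ y)
          (tiltedDensity_nonneg _ _) (by positivity)
        exact mul_le_mul habs hden
          (mul_nonneg (tiltedDensity_nonneg _ _) (tiltedDensity_nonneg _ _)) (by positivity)
    _ = Real.exp (C * |u x|) * Real.exp (C * |u y|) * expMoment P u c ^ 2 := by
        rw [hmul, hmul]; ring
    _ ≤ Real.exp (C * |u x|) * Real.exp (C * |u y|) * expMoment P u C ^ 2 := by gcongr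
    _ ≤ _ := (hAM _ _ _).trans (by rw [hD, hD]; gcongr)

end Bounds

end Tilting

section GaussianIntegrationByParts

lemma integrable_gaussianPDFReal_mul {v : ℝ≥0} (hv : v ≠ 0) {g : ℝ → ℝ}
    (hg : Integrable g (gaussianReal 0 v)) : Integrable fun u => gaussianPDFReal 0 v u * g u := by
  rw [gaussianReal_of_var_ne_zero _ hv, integrable_withDensity_iff_integrable_smul'
    (measurable_gaussianPDF _ _) (.of_forall fun _ => gaussianPDF_lt_top)] at hg
  simpa only [toReal_gaussianPDF, smul_eq_mul] using hg

lemma hasDerivAt_gaussianPDFReal {v : ℝ≥0} (hv : v ≠ 0) (u : ℝ) :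
    HasDerivAt (gaussianPDFReal 0 v) (-(u / v) * gaussianPDFReal 0 v u) u := by
  have hv' : (v : ℝ) ≠ 0 := by exact_mod_cast hv
  rw [gaussianPDFReal_def]
  have hsq : HasDerivAt (fun x : ℝ => -(x - 0) ^ 2 / (2 * v)) (-(u / v)) u := by
    refine ((((hasDerivAt_id u).sub_const 0).pow 2).neg.div_const (2 * (v : ℝ))).congr_deriv ?_
    simp only [id_eq, sub_zero]
    field_simp
    norm_num
  exact (hsq.exp.const_mul _).congr_deriv (by ring)

theorem integral_mul_gaussianReal (v : ℝ≥0) {f f' : ℝ → ℝ}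
    (hf : ∀ u, HasDerivAt f (f' u) u) (hi : Integrable f (gaussianReal 0 v))
    (hi' : Integrable f' (gaussianReal 0 v))
    (hui : Integrable (fun u => u * f u) (gaussianReal 0 v)) :
    ∫ u, u * f u ∂(gaussianReal 0 v) = v * ∫ u, f' u ∂(gaussianReal 0 v) := by
  rcases eq_or_ne v 0 with rfl | hv
  · simp
  have hv' : (v : ℝ) ≠ 0 := by exact_mod_cast hv
  have hparts := integral_mul_deriv_eq_deriv_mul_of_integrable (u := f) (v := gaussianPDFReal 0 v)
    (fun x _ => hf x) (fun x _ => hasDerivAt_gaussianPDFReal hv x)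
    (((integrable_gaussianPDFReal_mul hv hui).const_mul (-(v : ℝ)⁻¹)).congr
      (.of_forall fun u => by simp only [Pi.mul_apply]; field_simp))
    ((integrable_gaussianPDFReal_mul hv hi').congr (.of_forall fun u => mul_comm _ _))
    ((integrable_gaussianPDFReal_mul hv hi).congr (.of_forall fun u => mul_comm _ _))
  simp only [integral_gaussianReal_eq_integral_smul hv, smul_eq_mul]
  calc ∫ u, gaussianPDFReal 0 v u * (u * f u)
      = -v * ∫ u, f u * (-(u / v) * gaussianPDFReal 0 v u) := by
        rw [← integral_const_mul]
        congr with u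
        field_simp
    _ = v * ∫ u, gaussianPDFReal 0 v u * f' u := by
        rw [hparts, neg_mul_neg]
        simp only [mul_comm]

variable {T Ω : Type*} [MeasurableSpace T] [MeasurableSpace Ω] {μ : Measure Ω}
  {P : Measure T} {ξ : Ω → ℝ} {b : T → ℝ}
  {R : T → Ω → ℝ} {M : ℝ}

lemma integrable_exp_add_mul {r : T → ℝ} (hb : Measurable b) (hbM : ∀ y, |b y| ≤ M)
    (hr : Integrable (fun y => Real.exp (r y)) P) (s : ℝ) :
    Integrable (fun y => Real.exp (r y + s * b y)) P := by
  simp only [Real.exp_add]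
  refine hr.mul_bdd (c := Real.exp (|s| * M)) (hb.const_mul s).exp.aestronglyMeasurable
    (.of_forall fun y => ?_)
  rw [Real.norm_of_nonneg (Real.exp_pos _).le]
  refine Real.exp_le_exp.2 ((le_abs_self _).trans ?_)
  rw [abs_mul]
  exact mul_le_mul_of_nonneg_left (hbM y) (abs_nonneg s)

lemma integral_tilted_eq_div (e b : T → ℝ) :
    ∫ y, b y ∂(P.tilted e) = (∫ y, b y * Real.exp (e y) ∂P) / ∫ y, Real.exp (e y) ∂P := by
  rw [integral_tilted, ← integral_div]
  simp only [smul_eq_mul, mul_comm (b _), div_mul_eq_mul_div]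

lemma integral_mul_tiltedDensity_gaussian [IsProbabilityMeasure P] {v : ℝ≥0} (hξ : Measurable ξ)
    (hlaw : μ.map ξ = gaussianReal 0 v) {r : T → ℝ} (hb : Measurable b) (hbM : ∀ y, |b y| ≤ M)
    (hr : Integrable (fun y => Real.exp (r y)) P) (x : T)
    (hw : Integrable (fun ω => tiltedDensity P (fun y => r y + ξ ω * b y) x) μ)
    (hξw : Integrable (fun ω => ξ ω * tiltedDensity P (fun y => r y + ξ ω * b y) x) μ)
    (hw' : Integrable (fun ω => tiltedDensity P (fun y => r y + ξ ω * b y) x *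
      (b x - ∫ y, b y ∂(P.tilted fun y => r y + ξ ω * b y))) μ) :
    ∫ ω, ξ ω * tiltedDensity P (fun y => r y + ξ ω * b y) x ∂μ =
      v * ∫ ω, tiltedDensity P (fun y => r y + ξ ω * b y) x *
        (b x - ∫ y, b y ∂(P.tilted fun y => r y + ξ ω * b y)) ∂μ := by
  set f : ℝ → ℝ := fun s => tiltedDensity P (fun y => r y + s * b y) x
  set f' : ℝ → ℝ := fun s => f s * (b x - ∫ y, b y ∂(P.tilted fun y => r y + s * b y))
  have hderiv : ∀ s, HasDerivAt f (f' s) s := fun s =>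
    hasDerivAt_tiltedDensity_add_mul (integrable_exp_add_mul hb hbM hr) s x
  have hfm : Measurable f :=
    (continuous_iff_continuousAt.2 fun s => (hderiv s).continuousAt).measurable
  have hfm' : Measurable f' := (funext fun s => (hderiv s).deriv) ▸ measurable_deriv f
  have hfm₁ : Measurable fun s => s * f s := measurable_id.mul hfm
  have hint : ∀ {g : ℝ → ℝ}, Measurable g → Integrable (fun ω => g (ξ ω)) μ →
      Integrable g (gaussianReal 0 v) := fun hg h =>
    hlaw ▸ (integrable_map_measure hg.aestronglyMeasurable hξ.aemeasurable).2 h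
  have hcomp : ∀ {g : ℝ → ℝ}, Measurable g → ∫ ω, g (ξ ω) ∂μ = ∫ s, g s ∂(gaussianReal 0 v) :=
    fun hg => by rw [← hlaw, integral_map hξ.aemeasurable hg.aestronglyMeasurable]
  calc ∫ ω, ξ ω * f (ξ ω) ∂μ = ∫ s, s * f s ∂(gaussianReal 0 v) := hcomp hfm₁
    _ = v * ∫ s, f' s ∂(gaussianReal 0 v) :=
        integral_mul_gaussianReal v hderiv (hint hfm hw) (hint hfm' hw') (hint hfm₁ hξw)
    _ = v * ∫ ω, f' (ξ ω) ∂μ := by rw [hcomp hfm']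

variable [IsProbabilityMeasure μ]

lemma identDistrib_prodMk_of_indepFun {E F : Type*} [MeasurableSpace E] [MeasurableSpace F]
    {X : Ω → E} {Y : Ω → F} (hX : Measurable X) (hY : Measurable Y) (h : IndepFun X Y μ) :
    IdentDistrib (fun ω => (X ω, Y ω)) (fun p : Ω × Ω => (X p.1, Y p.2)) μ (μ.prod μ) := by
  refine ⟨(hX.prodMk hY).aemeasurable, by fun_prop, ?_⟩
  rw [(indepFun_iff_map_prod_eq_prod_map_map hX.aemeasurable hY.aemeasurable).1 h]
  exact Measure.map_prod_map _ _ hX hY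

variable [IsProbabilityMeasure P]

/-- The integrals over `y` of its components are the ingredients of the density at `x` and of the
mean of `b` under the tilting by `r + s b`, see `tiltedRatios`. -/
def tiltedIntegrand (b : T → ℝ) (x : T) (q : ℝ × (T → ℝ)) (y : T) : ℝ × ℝ × ℝ × ℝ :=
  (q.1, Real.exp (q.2 x + q.1 * b x), Real.exp (q.2 y + q.1 * b y),
    b y * Real.exp (q.2 y + q.1 * b y))

/-- The two quotients by the normalizing constant, which is the third component. -/
def tiltedRatios (q : ℝ × ℝ × ℝ × ℝ) : ℝ × ℝ × ℝ :=
  (q.1, q.2.1 / q.2.2.1, q.2.2.2 / q.2.2.1)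

lemma integrable_tiltedIntegrand (hb : Measurable b) (hbM : ∀ y, |b y| ≤ M) {r : T → ℝ}
    (hr : Integrable (fun y => Real.exp (r y)) P) (s : ℝ) (x : T) :
    Integrable (tiltedIntegrand b x (s, r)) P := by
  have hexp := integrable_exp_add_mul hb hbM hr s
  exact (integrable_const s).prodMk ((integrable_const _).prodMk
    (hexp.prodMk (hexp.bdd_mul hb.aestronglyMeasurable (.of_forall hbM))))

lemma tiltedRatios_integral_tiltedIntegrand (hb : Measurable b) (hbM : ∀ y, |b y| ≤ M) {r : T → ℝ}
    (hr : Integrable (fun y => Real.exp (r y)) P) (s : ℝ) (x : T) :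
    tiltedRatios (∫ y, tiltedIntegrand b x (s, r) y ∂P) =
      (s, tiltedDensity P (fun y => r y + s * b y) x,
        ∫ y, b y ∂(P.tilted fun y => r y + s * b y)) := by
  have hi := integrable_tiltedIntegrand hb hbM hr s x
  rw [tiltedRatios, fst_integral hi, snd_integral hi, fst_integral hi.snd, snd_integral hi.snd,
    fst_integral hi.snd.snd, snd_integral hi.snd.snd]
  simp only [tiltedIntegrand, tiltedDensity, integral_tilted_eq_div, integral_const,
    probReal_univ, one_smul]

-- Conditioning on the process `R` is not available, since it takes values in the nonstandard space
-- `T → ℝ`; instead `ξ` and `R` are placed on the two factors of a product space.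
lemma identDistrib_decouple (hξ : Measurable ξ) (hR : Measurable (Function.uncurry R))
    (hind : IndepFun ξ (fun ω y => R y ω) μ) (hb : Measurable b) (hbM : ∀ y, |b y| ≤ M)
    (hexp : ∀ᵐ ω ∂μ, Integrable (fun y => Real.exp (R y ω)) P) (x : T) :
    IdentDistrib
      (fun ω => (ξ ω, tiltedDensity P (fun y => R y ω + ξ ω * b y) x,
        ∫ y, b y ∂(P.tilted fun y => R y ω + ξ ω * b y)))
      (fun p : Ω × Ω => (ξ p.1, tiltedDensity P (fun y => R y p.2 + ξ p.1 * b y) x,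
        ∫ y, b y ∂(P.tilted fun y => R y p.2 + ξ p.1 * b y))) μ (μ.prod μ) := by
  have hexp' : ∀ᵐ p ∂μ.prod μ, Integrable (fun y => Real.exp (R y p.2)) P :=
    Measure.quasiMeasurePreserving_snd.ae hexp
  have hintegrand : Measurable (tiltedIntegrand b x) := by unfold tiltedIntegrand; fun_prop
  have hratios : Measurable tiltedRatios := by unfold tiltedRatios; fun_prop
  have hpath : Measurable fun ω y => R y ω :=
    measurable_pi_lambda _ fun y => hR.comp measurable_prodMk_left
  have huncurry : ∀ {Ω' : Type _} [MeasurableSpace Ω'] {s : Ω' → ℝ} {f : Ω' → Ω},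
      Measurable s → Measurable f → Measurable
        (Function.uncurry fun y p => tiltedIntegrand b x (s p, fun z => R z (f p)) y) :=
    fun hs hf => by
      have hx := (hpath.comp hf).eval (a := x)
      have hy := hR.comp (measurable_fst.prodMk (hf.comp measurable_snd))
      simp only [Function.comp_def, Function.uncurry_def] at hx hy
      simp only [tiltedIntegrand, Function.uncurry_def]
      fun_prop
  have hint := (identDistrib_integral (P := P) (huncurry hξ measurable_id)
    (huncurry (hξ.comp measurable_fst) measurable_snd)
    (hexp.mono fun ω hω => integrable_tiltedIntegrand hb hbM hω _ x)
    (hexp'.mono fun p hp => integrable_tiltedIntegrand hb hbM hp _ x)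
    ((identDistrib_prodMk_of_indepFun hξ hpath hind).comp hintegrand)).comp hratios
  exact (IdentDistrib.of_ae_eq hint.aemeasurable_fst
    (hexp.mono fun ω hω => tiltedRatios_integral_tiltedIntegrand hb hbM hω _ x)).symm.trans
      (hint.trans (IdentDistrib.of_ae_eq hint.aemeasurable_snd
        (hexp'.mono fun p hp => tiltedRatios_integral_tiltedIntegrand hb hbM hp _ x)))

theorem integral_mul_tiltedDensity_of_indepFun {v : ℝ≥0} (hξ : Measurable ξ)
    (hlaw : μ.map ξ = gaussianReal 0 v)
    (hR : Measurable (Function.uncurry R)) (hind : IndepFun ξ (fun ω y => R y ω) μ)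
    (hb : Measurable b) (hbM : ∀ y, |b y| ≤ M)
    (hexp : ∀ᵐ ω ∂μ, Integrable (fun y => Real.exp (R y ω)) P) (x : T)
    (hw : Integrable (fun ω => tiltedDensity P (fun y => R y ω + ξ ω * b y) x) μ)
    (hξw : Integrable (fun ω => ξ ω * tiltedDensity P (fun y => R y ω + ξ ω * b y) x) μ)
    (hw' : Integrable (fun ω => tiltedDensity P (fun y => R y ω + ξ ω * b y) x *
      (b x - ∫ y, b y ∂(P.tilted fun y => R y ω + ξ ω * b y))) μ) :
    ∫ ω, ξ ω * tiltedDensity P (fun y => R y ω + ξ ω * b y) x ∂μ =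
      v * ∫ ω, tiltedDensity P (fun y => R y ω + ξ ω * b y) x *
        (b x - ∫ y, b y ∂(P.tilted fun y => R y ω + ξ ω * b y)) ∂μ := by
  have hid := identDistrib_decouple hξ hR hind hb hbM hexp x
  have hid_density := hid.comp (u := fun q => q.2.1) (by fun_prop)
  have hid_mul := hid.comp (u := fun q => q.1 * q.2.1) (by fun_prop)
  have hid_deriv := hid.comp (u := fun q => q.2.1 * (b x - q.2.2)) (by fun_prop)
  have hw₂ : Integrable (fun p : Ω × Ω => tiltedDensity P (fun y => R y p.2 + ξ p.1 * b y) x)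
      (μ.prod μ) := hid_density.integrable_iff.1 hw
  have hξw₂ : Integrable (fun p : Ω × Ω => ξ p.1 *
      tiltedDensity P (fun y => R y p.2 + ξ p.1 * b y) x) (μ.prod μ) :=
    hid_mul.integrable_iff.1 hξw
  have hw'₂ : Integrable (fun p : Ω × Ω => tiltedDensity P (fun y => R y p.2 + ξ p.1 * b y) x *
      (b x - ∫ y, b y ∂(P.tilted fun y => R y p.2 + ξ p.1 * b y))) (μ.prod μ) :=
    hid_deriv.integrable_iff.1 hw'
  calc _ = ∫ p : Ω × Ω, ξ p.1 * tiltedDensity P (fun y => R y p.2 + ξ p.1 * b y) x ∂(μ.prod μ) :=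
        hid_mul.integral_eq
    _ = ∫ ω, v * ∫ ω', tiltedDensity P (fun y => R y ω + ξ ω' * b y) x *
          (b x - ∫ y, b y ∂(P.tilted fun y => R y ω + ξ ω' * b y)) ∂μ ∂μ := by
        rw [integral_prod_symm _ hξw₂]
        refine integral_congr_ae ?_
        filter_upwards [hexp, hw₂.prod_left_ae, hξw₂.prod_left_ae, hw'₂.prod_left_ae]
          with ω hω h₀ h₁ h₂
        exact integral_mul_tiltedDensity_gaussian hξ hlaw hb hbM hω x h₀ h₁ h₂
    _ = v * ∫ p : Ω × Ω, tiltedDensity P (fun y => R y p.2 + ξ p.1 * b y) x *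
          (b x - ∫ y, b y ∂(P.tilted fun y => R y p.2 + ξ p.1 * b y)) ∂(μ.prod μ) := by
        rw [integral_const_mul, integral_prod_symm _ hw'₂]
    _ = _ := congrArg ((v : ℝ) * ·) hid_deriv.integral_eq.symm

end GaussianIntegrationByParts

lemma isGaussianProcess_sum_mul {T S Ω ι : Type*} [MeasurableSpace Ω] [Fintype ι] {μ : Measure Ω}
    {X : T → Ω → ℝ} (hX : IsGaussianProcess X μ) (c : S → ι → ℝ) (f : S → ι → T) :
    IsGaussianProcess (fun s ω => ∑ i, c s i * X (f s i) ω) μ := by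
  classical
  exact hX.of_isGaussianProcess fun s => ⟨Finset.univ.image (f s),
    ∑ i, c s i • ContinuousLinearMap.proj (R := ℝ) (φ := fun _ => ℝ)
      (⟨f s i, Finset.mem_image_of_mem _ (Finset.mem_univ i)⟩ : Finset.univ.image (f s)),
    fun ω => by simp [Finset.restrict]⟩

/-- `U` is a jointly measurable centred Gaussian field with covariance function `K` and bounded
variance. -/
structure IsGaussianField {T Ω : Type*} [MeasurableSpace T] [MeasurableSpace Ω] (μ : Measure Ω)
    (U : T → Ω → ℝ) (K : T → T → ℝ) : Prop where
  measurable : Measurable (Function.uncurry U)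
  gaussian : IsGaussianProcess U μ
  mean : ∀ x, ∫ ω, U x ω ∂μ = 0
  covariance : ∀ x y, ∫ ω, U x ω * U y ω ∂μ = K x y
  bounded : ∃ v, ∀ x, K x x ≤ v

namespace IsGaussianField

variable {T Ω : Type*} [MeasurableSpace T] [MeasurableSpace Ω] {μ : Measure Ω}
  {U : T → Ω → ℝ} {K : T → T → ℝ}

lemma measurable_apply (h : IsGaussianField μ U K) (x : T) : Measurable (U x) :=
  h.measurable.comp measurable_prodMk_left

lemma measurable_realization (h : IsGaussianField μ U K) (ω : Ω) : Measurable fun x => U x ω :=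
  h.measurable.comp measurable_prodMk_right

lemma memLp_two (h : IsGaussianField μ U K) (x : T) : MemLp (U x) 2 μ :=
  (h.gaussian.hasGaussianLaw_eval x).memLp_two

lemma integrable_mul (h : IsGaussianField μ U K) (x y : T) :
    Integrable (fun ω => U x ω * U y ω) μ :=
  (h.memLp_two x).integrable_mul (h.memLp_two y)

lemma covariance_comm (h : IsGaussianField μ U K) (x y : T) : K x y = K y x := by
  simp only [← h.covariance, mul_comm]

lemma measurable_covariance [SFinite μ] (h : IsGaussianField μ U K) :
    Measurable (Function.uncurry K) := by
  have hK : Function.uncurry K = fun p => ∫ ω, U p.1 ω * U p.2 ω ∂μ :=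
    funext fun p => (h.covariance p.1 p.2).symm
  rw [hK]
  refine (StronglyMeasurable.integral_prod_right ?_).measurable
  exact ((h.measurable.comp ((measurable_fst.comp measurable_fst).prodMk measurable_snd)).mul
    (h.measurable.comp ((measurable_snd.comp measurable_fst).prodMk
      measurable_snd))).stronglyMeasurable

lemma covariance_sq_le (h : IsGaussianField μ U K) (x y : T) : K x y ^ 2 ≤ K x x * K y y := by
  have hquad : ∀ a b : ℝ, 0 ≤ a * a * K x x + 2 * (a * b) * K x y + b * b * K y y := fun a b => by
    have hexpand : ∫ ω, (a * U x ω + b * U y ω) ^ 2 ∂μ =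
        a * a * K x x + 2 * (a * b) * K x y + b * b * K y y := by
      simp only [← h.covariance, ← integral_const_mul]
      have hi : Integrable (fun ω => a * a * (U x ω * U x ω) + 2 * (a * b) * (U x ω * U y ω)) μ :=
        ((h.integrable_mul x x).const_mul _).add ((h.integrable_mul x y).const_mul _)
      rw [← integral_add ((h.integrable_mul x x).const_mul _) ((h.integrable_mul x y).const_mul _),
        ← integral_add hi ((h.integrable_mul y y).const_mul _)]
      exact integral_congr_ae (.of_forall fun ω => by simp only; ring)
    exact hexpand ▸ integral_nonneg fun ω => sq_nonneg _
  have hdiscrim := discrim_le_zero (a := K x x) (b := 2 * K x y) (c := K y y) fun s => by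
    linarith [hquad s 1]
  simp only [discrim] at hdiscrim
  linarith

lemma covariance_self_nonneg (h : IsGaussianField μ U K) (x : T) : 0 ≤ K x x :=
  h.covariance x x ▸ integral_nonneg fun _ => mul_self_nonneg _

lemma abs_covariance_le (h : IsGaussianField μ U K) {v : ℝ} (hv : ∀ x, K x x ≤ v) (x y : T) :
    |K x y| ≤ v := by
  have hx := h.covariance_self_nonneg x
  refine abs_le_of_sq_le_sq ((h.covariance_sq_le x y).trans ?_) (hx.trans (hv x))
  nlinarith [hv x, hv y, h.covariance_self_nonneg y]

lemma map_eq (h : IsGaussianField μ U K) (x : T) :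
    μ.map (U x) = gaussianReal 0 (K x x).toNNReal := by
  rw [(h.gaussian.hasGaussianLaw_eval x).map_eq_gaussianReal, h.mean,
    variance_of_integral_eq_zero (h.measurable_apply x).aemeasurable (h.mean x), ← h.covariance x x]
  simp only [sq]

lemma sum {S ι : Type*} [MeasurableSpace S] [Fintype ι] (h : IsGaussianField μ U K)
    {φ : ι → S → T} (hφ : ∀ i, Measurable (φ i)) :
    IsGaussianField μ (fun y ω => ∑ i, U (φ i y) ω)
      (fun y z => ∑ i, ∑ j, K (φ i y) (φ j z)) where
  measurable := Finset.measurable_fun_sum _ fun i _ =>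
    h.measurable.comp (((hφ i).comp measurable_fst).prodMk measurable_snd)
  gaussian := by simpa using isGaussianProcess_sum_mul h.gaussian (fun _ _ => 1) fun y i => φ i y
  mean y := by
    rw [integral_finsetSum _ fun i _ => (h.gaussian.hasGaussianLaw_eval _).integrable]
    simp only [h.mean, Finset.sum_const_zero]
  covariance y z := by
    simp only [Finset.sum_mul_sum]
    rw [integral_finsetSum _ fun i _ => integrable_finsetSum _ fun j _ => h.integrable_mul _ _]
    refine Finset.sum_congr rfl fun i _ => ?_
    rw [integral_finsetSum _ fun j _ => h.integrable_mul _ _]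
    simp only [h.covariance]
  bounded := by
    obtain ⟨v, hv⟩ := h.bounded
    exact ⟨∑ _i : ι, ∑ _j : ι, v, fun y => Finset.sum_le_sum fun i _ => Finset.sum_le_sum fun j _ =>
      (le_abs_self _).trans (h.abs_covariance_le hv _ _)⟩

lemma indepFun_sub_proj (h : IsGaussianField μ U K) (z : T) (β : ℝ) :
    IndepFun (U z) (fun ω y => β * U y ω - U z ω * (β * (K z y / K z z))) μ := by
  have := h.gaussian.isProbabilityMeasure
  let R : T → Ω → ℝ := fun y ω => β * U y ω - U z ω * (β * (K z y / K z z))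
  have hjoint : IsGaussianProcess (Sum.elim (fun _ : Unit => U z) R) μ := by
    convert isGaussianProcess_sum_mul h.gaussian (ι := Fin 2)
      (Sum.elim (fun _ => ![1, 0]) fun y => ![β, -(β * (K z y / K z z))])
      (Sum.elim (fun _ => ![z, z]) fun y => ![y, z]) using 2 with s
    funext ω
    rcases s with s | y
    · simp
    · simp only [R, Sum.elim_inr, Fin.sum_univ_two, Matrix.cons_val_zero, Matrix.cons_val_one]
      ring
  have hR : ∀ y, MemLp (R y) 2 μ := fun y =>
    ((h.memLp_two y).const_mul β).sub ((h.memLp_two z).mul_const _)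
  have hcov : ∀ (_ : Unit) (y : T), cov[U z, R y; μ] = 0 := fun _ y => by
    rw [covariance_eq_sub (h.memLp_two z) (hR y), h.mean, zero_mul, sub_zero]
    have hzero : K z z = 0 → K z y = 0 := fun h0 => by
      simpa [h0] using h.covariance_sq_le z y
    calc ∫ ω, U z ω * R y ω ∂μ
        = ∫ ω, (β * (U z ω * U y ω) - β * (K z y / K z z) * (U z ω * U z ω)) ∂μ := by
          congr with ω; simp only [R]; ring
      _ = β * K z y - β * (K z y / K z z) * K z z := by
          rw [integral_sub ((h.integrable_mul z y).const_mul _)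
            ((h.integrable_mul z z).const_mul _), integral_const_mul, integral_const_mul,
            h.covariance, h.covariance]
      _ = 0 := by rw [mul_assoc, div_mul_cancel_of_imp hzero, sub_self]
  exact (hjoint.indepFun_of_covariance_eq_zero (fun _ => (h.measurable_apply z).aemeasurable)
    (fun y => (hR y).aemeasurable) hcov).comp (measurable_pi_apply ()) measurable_id

section ExponentialMoments

lemma integrable_exp_mul (h : IsGaussianField μ U K) (x : T) (c : ℝ) :
    Integrable (fun ω => Real.exp (c * U x ω)) μ :=
  (h.map_eq x ▸ integrable_exp_mul_gaussianReal c :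
    Integrable (fun s => Real.exp (c * s)) (μ.map (U x))).comp_measurable (h.measurable_apply x)

lemma integrable_exp_abs (h : IsGaussianField μ U K) (x : T) (c : ℝ) :
    Integrable (fun ω => Real.exp (c * |U x ω|)) μ :=
  integrable_exp_mul_abs (h.integrable_exp_mul x c) (h.integrable_exp_mul x (-c))

lemma integral_exp_abs_le (h : IsGaussianField μ U K) {v : ℝ} (hv : ∀ x, K x x ≤ v) (x : T)
    (c : ℝ) : ∫ ω, Real.exp (c * |U x ω|) ∂μ ≤ 2 * Real.exp (v * c ^ 2 / 2) := by
  have hmgf : ∀ d : ℝ, ∫ ω, Real.exp (d * U x ω) ∂μ = Real.exp (K x x * d ^ 2 / 2) := fun d => by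
    have := mgf_gaussianReal (h.map_eq x) d
    rwa [zero_mul, zero_add, Real.coe_toNNReal _ (h.covariance_self_nonneg x)] at this
  calc ∫ ω, Real.exp (c * |U x ω|) ∂μ
      ≤ ∫ ω, (Real.exp (c * U x ω) + Real.exp (-c * U x ω)) ∂μ := by
        refine integral_mono (h.integrable_exp_abs x c)
          ((h.integrable_exp_mul x c).add (h.integrable_exp_mul x (-c))) fun ω => ?_
        rcases abs_cases (U x ω) with ⟨ha, -⟩ | ⟨ha, -⟩
        · rw [ha]; exact le_add_of_nonneg_right (Real.exp_pos _).le
        · rw [ha, mul_neg, ← neg_mul]; exact le_add_of_nonneg_left (Real.exp_pos _).le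
    _ = 2 * Real.exp (K x x * c ^ 2 / 2) := by
        rw [integral_add (h.integrable_exp_mul x c) (h.integrable_exp_mul x (-c)), hmgf, hmgf,
          neg_sq, two_mul]
    _ ≤ _ := by gcongr; exact hv x

variable [IsProbabilityMeasure μ]

lemma integrable_mul_exp_abs {S : Type*} [MeasurableSpace S] {ν : Measure S} [SFinite ν]
    (h : IsGaussianField μ U K) {φ : S → T} (hφ : Measurable φ) {B : S → ℝ} (hB : Integrable B ν)
    (c : ℝ) :
    Integrable (fun p : Ω × S => B p.2 * Real.exp (c * |U (φ p.2) p.1|)) (μ.prod ν) := by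
  obtain ⟨v, hv⟩ := h.bounded
  have hm : Measurable fun p : Ω × S => Real.exp (c * |U (φ p.2) p.1|) :=
    ((h.measurable.comp ((hφ.comp measurable_snd).prodMk measurable_fst)).abs.const_mul c).exp
  refine (integrable_prod_iff' (hB.1.comp_snd.mul hm.aestronglyMeasurable)).2
    ⟨.of_forall fun y => (h.integrable_exp_abs (φ y) c).const_mul (B y), ?_⟩
  have hnorm : ∀ y, ∫ ω, ‖B y * Real.exp (c * |U (φ y) ω|)‖ ∂μ =
      ‖B y‖ * ∫ ω, Real.exp (c * |U (φ y) ω|) ∂μ := fun y => by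
    simp only [norm_mul, Real.norm_of_nonneg (Real.exp_pos _).le, integral_const_mul]
  refine Integrable.congr ?_ (.of_forall fun y => (hnorm y).symm)
  refine hB.norm.mul_bdd (c := 2 * Real.exp (v * c ^ 2 / 2))
    hm.stronglyMeasurable.integral_prod_left'.aestronglyMeasurable (.of_forall fun y => ?_)
  rw [Real.norm_of_nonneg (integral_nonneg fun _ => (Real.exp_pos _).le)]
  exact h.integral_exp_abs_le hv (φ y) c

variable {P : Measure T} [IsProbabilityMeasure P]

lemma integrable_exp_abs_prod (h : IsGaussianField μ U K) (c : ℝ) :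
    Integrable (fun p : Ω × T => Real.exp (c * |U p.2 p.1|)) (μ.prod P) := by
  simpa using h.integrable_mul_exp_abs measurable_id (integrable_const (1 : ℝ)) (ν := P) c

lemma integrable_expMoment (h : IsGaussianField μ U K) (c : ℝ) :
    Integrable (fun ω => expMoment P (fun y => U y ω) c) μ :=
  (h.integrable_exp_abs_prod c).integral_prod_left

lemma ae_integrable_exp_abs (h : IsGaussianField μ U K) :
    ∀ᵐ ω ∂μ, ∀ c : ℝ, Integrable (fun y => Real.exp (c * |U y ω|)) P := by
  have hnat : ∀ᵐ ω ∂μ, ∀ n : ℕ, Integrable (fun y => Real.exp (n * |U y ω|)) P :=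
    ae_all_iff.2 fun n => (h.integrable_exp_abs_prod n).prod_right_ae
  filter_upwards [hnat] with ω hω c
  obtain ⟨n, hn⟩ := exists_nat_ge c
  refine (hω n).mono' ((h.measurable_realization ω).abs.const_mul c).exp.aestronglyMeasurable
    (.of_forall fun y => ?_)
  rw [Real.norm_of_nonneg (Real.exp_pos _).le]
  exact Real.exp_le_exp.2 (mul_le_mul_of_nonneg_right hn (abs_nonneg _))

end ExponentialMoments

end IsGaussianField

section ProductMeasure

variable {S ι κ : Type*} [MeasurableSpace S] [Fintype ι] [Fintype κ]

lemma tiltedDensity_pi (P : ι → Measure S) [∀ i, IsProbabilityMeasure (P i)] (e : ι → S → ℝ)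
    (X : ι → S) :
    tiltedDensity (Measure.pi P) (fun Y => ∑ i, e i (Y i)) X =
      ∏ i, tiltedDensity (P i) (e i) (X i) := by
  simp only [tiltedDensity, Real.exp_sum, Finset.prod_div_distrib]
  rw [integral_fintype_prod_eq_prod fun i x => Real.exp (e i x)]

lemma lintegral_pi_prod (P : ι → Measure S) [∀ i, IsProbabilityMeasure (P i)]
    {g : ι → S → ℝ≥0∞} (hg : ∀ i, Measurable (g i)) :
    ∫⁻ X, ∏ i, g i (X i) ∂(Measure.pi P) = ∏ i, ∫⁻ x, g i x ∂(P i) := by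
  have hind : iIndepFun (fun i (X : ι → S) => g i (X i)) (Measure.pi P) :=
    iIndepFun_pi fun i => (hg i).aemeasurable
  rw [lintegral_prod_eq_prod_lintegral_of_indepFun Finset.univ _ hind
    fun i => (hg i).comp (measurable_pi_apply i)]
  exact Finset.prod_congr rfl fun i _ => (measurePreserving_eval P i).lintegral_comp (hg i)

lemma pi_withDensity (P : ι → Measure S) [∀ i, IsProbabilityMeasure (P i)]
    {g : ι → S → ℝ≥0∞} (hg : ∀ i, Measurable (g i)) [∀ i, SigmaFinite ((P i).withDensity (g i))] :
    Measure.pi (fun i => (P i).withDensity (g i)) =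
      (Measure.pi P).withDensity fun X => ∏ i, g i (X i) := by
  refine Measure.pi_eq fun s hs => ?_
  have hind : (univ.pi s).indicator (fun X : ι → S => ∏ i, g i (X i)) =
      fun X => ∏ i, (s i).indicator (g i) (X i) := by
    funext X
    by_cases hX : X ∈ univ.pi s
    · rw [indicator_of_mem hX]
      exact Finset.prod_congr rfl fun i _ => (indicator_of_mem (hX i trivial) _).symm
    · rw [indicator_of_notMem hX]
      obtain ⟨i, hi⟩ : ∃ i, X i ∉ s i := by simpa using hX
      exact (Finset.prod_eq_zero (Finset.mem_univ i) (indicator_of_notMem hi _)).symm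
  rw [withDensity_apply _ (MeasurableSet.univ_pi hs),
    ← lintegral_indicator (MeasurableSet.univ_pi hs), hind,
    lintegral_pi_prod P fun i => (hg i).indicator (hs i)]
  refine Finset.prod_congr rfl fun i _ => ?_
  rw [withDensity_apply _ (hs i), lintegral_indicator (hs i)]

lemma pi_tilted (P : ι → Measure S) [∀ i, IsProbabilityMeasure (P i)] {e : ι → S → ℝ}
    (he : ∀ i, Measurable (e i)) :
    Measure.pi (fun i => (P i).tilted (e i)) = (Measure.pi P).tilted fun X => ∑ i, e i (X i) := by
  have : ∀ i, SigmaFinite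
      ((P i).withDensity fun x => ENNReal.ofReal (tiltedDensity (P i) (e i) x)) :=
    fun i => inferInstanceAs (SigmaFinite ((P i).tilted (e i)))
  calc Measure.pi (fun i => (P i).tilted (e i))
      = (Measure.pi P).withDensity fun X =>
          ∏ i, ENNReal.ofReal (tiltedDensity (P i) (e i) (X i)) :=
        pi_withDensity P fun i => ((he i).exp.div_const _).ennreal_ofReal
    _ = (Measure.pi P).withDensity fun X =>
          ENNReal.ofReal (tiltedDensity (Measure.pi P) (fun Y => ∑ i, e i (Y i)) X) := by
        simp only [tiltedDensity_pi,
          ENNReal.ofReal_prod_of_nonneg fun _ _ => tiltedDensity_nonneg _ _]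
    _ = _ := rfl

lemma measurePreserving_comp_pi (m : κ → Measure S) [∀ k, IsProbabilityMeasure (m k)] {f : ι → κ}
    (hf : Function.Injective f) :
    MeasurePreserving (fun (X : κ → S) i => X (f i)) (Measure.pi m)
      (Measure.pi fun i => m (f i)) := by
  refine ⟨by fun_prop, ?_⟩
  have hind : iIndepFun (fun i (X : κ → S) => X (f i)) (Measure.pi m) :=
    (iIndepFun_pi (X := fun _ x => x) fun _ => aemeasurable_id).precomp hf
  rw [(iIndepFun_iff_map_fun_eq_pi_map fun i => (measurable_pi_apply _).aemeasurable).1 hind]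
  simp only [(measurePreserving_eval m _).map_eq]

lemma measurePreserving_uncurry (m : ι → Measure S) [∀ i, IsProbabilityMeasure (m i)] :
    MeasurePreserving (fun (X : κ → ι → S) (p : κ × ι) => X p.1 p.2)
      (Measure.pi fun _ => Measure.pi m) (Measure.pi fun p => m p.2) := by
  refine ⟨by fun_prop, ?_⟩
  simp only [← Measure.infinitePi_eq_pi]
  exact Measure.infinitePi_map_curry_symm fun _ => m

lemma integral_pi_sum_comp (ν : Measure S) [IsProbabilityMeasure ν] {f : S → ℝ}
    (hf : Integrable f ν) :
    ∫ X, ∑ i, f (X i) ∂(Measure.pi fun _ : ι => ν) = Fintype.card ι * ∫ x, f x ∂ν := by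
  rw [integral_finsetSum _ fun i _ => integrable_comp_eval (μ := fun _ => ν) hf]
  simp [integral_comp_eval (μ := fun _ => ν) hf.1]

lemma integral_pi_fin_three (ν : Measure S) [IsProbabilityMeasure ν] {f : S → S → S → ℝ}
    (hf : Integrable (fun X : Fin 3 → S => f (X 0) (X 1) (X 2)) (Measure.pi fun _ => ν)) :
    ∫ X : Fin 3 → S, f (X 0) (X 1) (X 2) ∂(Measure.pi fun _ => ν) =
      ∫ x, ∫ y, ∫ z, f x y z ∂ν ∂ν ∂ν := by
  let e : (Fin 3 → S) ≃ᵐ S × S × S := (MeasurableEquiv.piFinSuccAbove (fun _ => S) 0).trans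
    (MeasurableEquiv.prodCongr (.refl S) MeasurableEquiv.finTwoArrow)
  have he : MeasurePreserving e (Measure.pi fun _ => ν) (ν.prod (ν.prod ν)) :=
    ((MeasurePreserving.id ν).prod (measurePreserving_finTwoArrow ν)).comp
      (measurePreserving_piFinSuccAbove (fun _ => ν) 0)
  have hi : Integrable (fun p : S × S × S => f p.1 p.2.1 p.2.2) (ν.prod (ν.prod ν)) :=
    (he.integrable_comp_emb e.measurableEmbedding).1 hf
  calc _ = ∫ p : S × S × S, f p.1 p.2.1 p.2.2 ∂(ν.prod (ν.prod ν)) :=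
        he.integral_comp' fun p : S × S × S => f p.1 p.2.1 p.2.2
    _ = ∫ x, ∫ q : S × S, f x q.1 q.2 ∂(ν.prod ν) ∂ν := integral_prod _ hi
    _ = _ := by
        refine integral_congr_ae ?_
        filter_upwards [hi.prod_right_ae] with x hx
        exact integral_prod _ hx

end ProductMeasure

namespace IsGaussianField

variable {T Ω : Type*} [MeasurableSpace T] [MeasurableSpace Ω] {μ : Measure Ω}
  {U : T → Ω → ℝ} {K : T → T → ℝ}
  {P : Measure T} [IsProbabilityMeasure P]

lemma measurable_integral_exp (h : IsGaussianField μ U K) (β : ℝ) :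
    Measurable fun ω => ∫ y, Real.exp (β * U y ω) ∂P :=
  measurable_integral_of_uncurry (h.measurable.const_mul β).exp

lemma measurable_integral_tilted (h : IsGaussianField μ U K) (β : ℝ) {b : T → ℝ}
    (hb : Measurable b) :
    Measurable fun ω => ∫ y, b y ∂(P.tilted fun y => β * U y ω) := by
  simp only [integral_tilted_eq_div]
  exact (measurable_integral_of_uncurry ((hb.comp measurable_fst).mul
    (h.measurable.const_mul β).exp)).div (h.measurable_integral_exp β)

lemma measurable_tiltedDensity (h : IsGaussianField μ U K) (β : ℝ) :
    Measurable fun p : Ω × T => tiltedDensity P (fun y => β * U y p.1) p.2 :=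
  ((h.measurable.comp measurable_swap).const_mul β).exp.div
    ((h.measurable_integral_exp β).comp measurable_fst)

lemma aestronglyMeasurable_mul_tiltedDensity (h : IsGaussianField μ U K)
    {B : T → ℝ} (hB : AEStronglyMeasurable B P) (β : ℝ) :
    AEStronglyMeasurable
      (fun p : Ω × T => B p.2 * tiltedDensity P (fun y => β * U y p.1) p.2) (μ.prod P) :=
  hB.comp_snd.mul (h.measurable_tiltedDensity β).aestronglyMeasurable

lemma measurable_tiltedDensity_mul_tiltedDensity (h : IsGaussianField μ U K) (β : ℝ) :
    Measurable fun p : Ω × T × T => tiltedDensity P (fun z => β * U z p.1) p.2.1 *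
      tiltedDensity P (fun z => β * U z p.1) p.2.2 :=
  ((h.measurable_tiltedDensity β).comp (measurable_fst.prodMk measurable_snd.fst)).mul
    ((h.measurable_tiltedDensity β).comp (measurable_fst.prodMk measurable_snd.snd))

variable [IsProbabilityMeasure μ]

lemma memLp_two_tiltedDensity (h : IsGaussianField μ U K) (β : ℝ) (x : T) :
    MemLp (fun ω => tiltedDensity P (fun y => β * U y ω) x) 2 μ := by
  have hm := (h.measurable_tiltedDensity (P := P) β).comp (measurable_prodMk_right (y := x))
  refine (memLp_two_iff_integrable_sq hm.aestronglyMeasurable).2 ?_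
  refine ((h.integrable_exp_abs x (4 * |β|)).add (h.integrable_expMoment (P := P) (4 * |β|))).mono'
    (hm.pow_const 2).aestronglyMeasurable ?_
  filter_upwards [h.ae_integrable_exp_abs (P := P)] with ω hω
  rw [Real.norm_of_nonneg (sq_nonneg _)]
  exact tiltedDensity_sq_le (h.measurable_realization ω) hω le_rfl x

theorem integral_mul_tiltedDensity (h : IsGaussianField μ U K) (β : ℝ) (z x : T) :
    ∫ ω, U z ω * tiltedDensity P (fun y => β * U y ω) x ∂μ =
      β * ∫ ω, tiltedDensity P (fun y => β * U y ω) x *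
        (K z x - ∫ y, K z y ∂(P.tilted fun y => β * U y ω)) ∂μ := by
  obtain ⟨v, hv⟩ := h.bounded
  set b : T → ℝ := fun y => β * (K z y / K z z) with hb
  have hKm : Measurable (K z) := h.measurable_covariance.comp measurable_prodMk_left
  have hbm : Measurable b := (hKm.div_const _).const_mul β
  have hbM : ∀ y, |b y| ≤ |β| * (v / |K z z|) := fun y => by
    rw [hb, abs_mul, abs_div]
    gcongr
    exact h.abs_covariance_le hv z y
  have hsplit : ∀ ω, (fun y => β * U y ω - U z ω * b y + U z ω * b y) = fun y => β * U y ω :=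
    fun ω => funext fun y => sub_add_cancel _ _
  have hw := (h.memLp_two_tiltedDensity (P := P) β x).integrable one_le_two
  have hzb : ∀ y, K z z * b y = β * K z y := fun y => by
    rw [hb, mul_left_comm, mul_div_cancel_of_imp']
    exact fun h0 => by simpa [h0] using h.covariance_sq_le z y
  have hzw : Integrable (fun ω => U z ω * tiltedDensity P (fun y => β * U y ω) x) μ :=
    (h.memLp_two z).integrable_mul (h.memLp_two_tiltedDensity β x)
  have key := integral_mul_tiltedDensity_of_indepFun (P := P) (h.measurable_apply z) (h.map_eq z)
    (R := fun y ω => β * U y ω - U z ω * b y)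
    ((h.measurable.const_mul β).sub (((h.measurable_apply z).comp measurable_snd).mul
      (hbm.comp measurable_fst))) (h.indepFun_sub_proj z β) hbm hbM ?_ x
    (by simpa only [hsplit] using hw)
    (by simpa only [hsplit] using hzw)
    ?_
  · simp only [hsplit, Real.coe_toNNReal _ (h.covariance_self_nonneg z)] at key
    rw [key, ← integral_const_mul, ← integral_const_mul]
    congr with ω
    rw [mul_left_comm, mul_sub, hzb, ← integral_const_mul]
    simp only [hzb, integral_const_mul]
    ring
  · filter_upwards [h.ae_integrable_exp_abs (P := P)] with ω hω
    simpa only [neg_mul, ← sub_eq_add_neg] using integrable_exp_add_mul hbm hbM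
      (integrable_exp_const_mul (h.measurable_realization ω) hω β) (-U z ω)
  · simp only [hsplit]
    exact hw.mul_bdd (c := |b x| + |β| * (v / |K z z|))
      (measurable_const.sub (h.measurable_integral_tilted β hbm)).aestronglyMeasurable
      (.of_forall fun ω => (abs_sub _ _).trans (by gcongr; exact abs_integral_tilted_le hbM _))

end IsGaussianField

section TwoReplicas

variable {T : Type*} [MeasurableSpace T] {P : Measure T} {u : T → ℝ}
  {β c : ℝ} (hm : Measurable u) (hu : ∀ C : ℝ, Integrable (fun y => Real.exp (C * |u y|)) P)

include hm hu

lemma mem_interior_integrableExpSet (β : ℝ) : β ∈ interior (integrableExpSet u P) := by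
  rw [show integrableExpSet u P = univ from
    eq_univ_of_forall fun s => integrable_exp_const_mul hm hu s, interior_univ]
  trivial

variable [IsProbabilityMeasure P]

lemma tiltedDensity_mul_sub_integral (β : ℝ) (x : T) :
    tiltedDensity P (fun y => β * u y) x * (u x - ∫ y, u y ∂(P.tilted fun y => β * u y)) =
      ∫ y, (u x - u y) *
        (tiltedDensity P (fun z => β * u z) x * tiltedDensity P (fun z => β * u z) y) ∂P := by
  have hexp := integrable_exp_const_mul hm hu β
  have hw : Integrable (tiltedDensity P fun y => β * u y) P := hexp.div_const _
  have huw : Integrable (fun y => tiltedDensity P (fun z => β * u z) y * u y) P := by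
    have := (memLp_tilted_mul (mem_interior_integrableExpSet hm hu β) 1).integrable le_rfl
    exact (integrable_tilted_iff hexp _).1 this |>.div_const (∫ y, Real.exp (β * u y) ∂P) |>.congr
      (.of_forall fun y => by simp only [tiltedDensity, smul_eq_mul]; ring)
  calc _ = tiltedDensity P (fun z => β * u z) x *
        (u x * ∫ y, tiltedDensity P (fun z => β * u z) y ∂P -
          ∫ y, tiltedDensity P (fun z => β * u z) y * u y ∂P) := by
        rw [integral_tiltedDensity hexp, mul_one, integral_tilted_eq_tiltedDensity]
    _ = _ := by
        rw [← integral_const_mul, ← integral_sub (hw.const_mul _) huw, ← integral_const_mul]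
        congr with y
        ring

lemma abs_tiltedDensity_mul_sub_integral_le (hβ : |β| ≤ c) (x : T) :
    |tiltedDensity P (fun y => β * u y) x * (u x - ∫ y, u y ∂(P.tilted fun y => β * u y))| ≤
      Real.exp (4 * (c + 1) * |u x|) + 2 * expMoment P u (4 * (c + 1)) := by
  rw [tiltedDensity_mul_sub_integral hm hu]
  calc |∫ y, (u x - u y) *
        (tiltedDensity P (fun z => β * u z) x * tiltedDensity P (fun z => β * u z) y) ∂P|
      ≤ ∫ y, (Real.exp (4 * (c + 1) * |u x|) + expMoment P u (4 * (c + 1)) +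
          Real.exp (4 * (c + 1) * |u y|)) ∂P := by
        refine norm_integral_le_of_norm_le (G := ℝ) ((integrable_const _).add (hu _))
          (.of_forall fun y => ?_)
        rw [norm_mul, Real.norm_eq_abs, Real.norm_of_nonneg
          (mul_nonneg (tiltedDensity_nonneg _ _) (tiltedDensity_nonneg _ _))]
        linarith [abs_sub_mul_tiltedDensity_le hm hu hβ x y]
    _ = _ := by
        rw [integral_add (integrable_const _) (hu _), integral_const, probReal_univ, one_smul,
          two_mul, ← add_assoc]
        rfl

end TwoReplicas

/-- The mean of `B` under the random tilting of `P` by the field `β U`, averaged over the field. -/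
def tiltedMean {T Ω : Type*} [MeasurableSpace T] [MeasurableSpace Ω] (μ : Measure Ω)
    (U : T → Ω → ℝ) (P : Measure T) (β : ℝ) (B : T → ℝ) : ℝ :=
  ∫ ω, ∫ x, B x ∂(P.tilted fun y => β * U y ω) ∂μ

namespace IsGaussianField

variable {T Ω : Type*} [MeasurableSpace T] [MeasurableSpace Ω] {μ : Measure Ω}
  [IsProbabilityMeasure μ] {U : T → Ω → ℝ} {K : T → T → ℝ}
  {P : Measure T} [IsProbabilityMeasure P] {B : T → ℝ}

lemma integrable_mul_expMoment (h : IsGaussianField μ U K) {S : Type*} [MeasurableSpace S]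
    {ν : Measure S} [SFinite ν] {B : S → ℝ} (hB : Integrable B ν) (c : ℝ) :
    Integrable (fun p : Ω × S => B p.2 * expMoment P (fun y => U y p.1) c) (μ.prod ν) := by
  simpa only [mul_comm] using (h.integrable_expMoment c).mul_prod hB

lemma ae_prod_integrable_exp_abs (h : IsGaussianField μ U K) {S : Type*} [MeasurableSpace S]
    (ν : Measure S) [SFinite ν] :
    ∀ᵐ p : Ω × S ∂(μ.prod ν), ∀ c : ℝ, Integrable (fun y => Real.exp (c * |U y p.1|)) P :=
  Measure.quasiMeasurePreserving_fst.ae h.ae_integrable_exp_abs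

lemma integrable_mul_tiltedDensity (h : IsGaussianField μ U K) (hB : Integrable B P) (β : ℝ) :
    Integrable (fun p : Ω × T => B p.2 * tiltedDensity P (fun y => β * U y p.1) p.2)
      (μ.prod P) := by
  refine ((h.integrable_mul_exp_abs measurable_id hB.norm (4 * |β|)).add
    (h.integrable_mul_expMoment (P := P) hB.norm (4 * |β|))).mono'
    (h.aestronglyMeasurable_mul_tiltedDensity hB.1 β) ?_
  filter_upwards [h.ae_prod_integrable_exp_abs (P := P) P] with p hp
  rw [norm_mul, Real.norm_of_nonneg (tiltedDensity_nonneg _ _)]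
  refine (mul_le_mul_of_nonneg_left
    (tiltedDensity_le_add (h.measurable_realization p.1) hp le_rfl p.2) (norm_nonneg _)).trans_eq ?_
  rw [mul_add]; rfl

lemma tiltedMean_eq_integral_prod (h : IsGaussianField μ U K) (hB : Integrable B P) (β : ℝ) :
    tiltedMean μ U P β B =
      ∫ p, B p.2 * tiltedDensity P (fun y => β * U y p.1) p.2 ∂(μ.prod P) := by
  rw [integral_prod _ (h.integrable_mul_tiltedDensity hB β)]
  simp only [tiltedMean, integral_tilted_eq_tiltedDensity, mul_comm]

lemma hasDerivAt_tiltedMean_prod (h : IsGaussianField μ U K) (hB : Integrable B P) (β : ℝ) :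
    HasDerivAt (fun b => tiltedMean μ U P b B)
      (∫ p, B p.2 * (tiltedDensity P (fun y => β * U y p.1) p.2 *
        (U p.2 p.1 - ∫ y, U y p.1 ∂(P.tilted fun y => β * U y p.1))) ∂(μ.prod P)) β := by
  simp only [h.tiltedMean_eq_integral_prod hB]
  have hmean : Measurable fun ω => ∫ y, U y ω ∂(P.tilted fun y => β * U y ω) := by
    simp only [integral_tilted_eq_div]
    exact (measurable_integral_of_uncurry
      (h.measurable.mul (h.measurable.const_mul β).exp)).div (h.measurable_integral_exp β)
  set c := |β| + 1
  refine (hasDerivAt_integral_of_dominated_loc_of_deriv_le (Metric.ball_mem_nhds β one_pos)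
    (bound := fun p => ‖B p.2‖ * Real.exp (4 * (c + 1) * |U p.2 p.1|) +
      ‖B p.2‖ * expMoment P (fun y => U y p.1) (4 * (c + 1)) * 2)
    (F' := fun b p => B p.2 * (tiltedDensity P (fun y => b * U y p.1) p.2 *
        (U p.2 p.1 - ∫ y, U y p.1 ∂(P.tilted fun y => b * U y p.1))))
    (.of_forall fun b => h.aestronglyMeasurable_mul_tiltedDensity hB.1 b)
    (h.integrable_mul_tiltedDensity hB β) ?_ ?_
    ((h.integrable_mul_exp_abs measurable_id hB.norm _).add
      ((h.integrable_mul_expMoment hB.norm _).mul_const 2)) ?_).2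
  · exact hB.1.comp_snd.mul ((h.measurable_tiltedDensity β).mul
      ((h.measurable.comp measurable_swap).sub
        (hmean.comp measurable_fst))).aestronglyMeasurable
  · filter_upwards [h.ae_prod_integrable_exp_abs (P := P) P] with p hp b hb
    have hb' : |b| ≤ c := by
      have := abs_sub_abs_le_abs_sub b β
      rw [Metric.mem_ball, Real.dist_eq] at hb
      linarith
    rw [norm_mul]
    exact (mul_le_mul_of_nonneg_left (abs_tiltedDensity_mul_sub_integral_le
      (h.measurable_realization p.1) hp hb' p.2) (norm_nonneg _)).trans_eq (by ring)
  · filter_upwards [h.ae_prod_integrable_exp_abs (P := P) P] with p hp b _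
    exact (hasDerivAt_tiltedDensity_mul
      (mem_interior_integrableExpSet (h.measurable_realization p.1) hp b) p.2).const_mul (B p.2)

end IsGaussianField

lemma tiltedDensity_replicas {T Ω : Type*} [MeasurableSpace T] {P : Measure T}
    [IsProbabilityMeasure P] {U : T → Ω → ℝ} (β : ℝ) {n : ℕ} (q : Fin n → T) (ω : Ω) :
    tiltedDensity (Measure.pi fun _ => P) (fun Y : Fin n → T => β * ∑ i, U (Y i) ω) q =
      ∏ i, tiltedDensity P (fun y => β * U y ω) (q i) := by
  simp only [Finset.mul_sum]
  exact tiltedDensity_pi (fun _ => P) (fun _ y => β * U y ω) q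

namespace IsGaussianField

variable {T Ω : Type*} [MeasurableSpace T] [MeasurableSpace Ω] {μ : Measure Ω}
  {U : T → Ω → ℝ} {K : T → T → ℝ}

lemma replicas (h : IsGaussianField μ U K) (ι : Type*) [Fintype ι] :
    IsGaussianField μ (fun (q : ι → T) ω => ∑ i, U (q i) ω)
      (fun q q' => ∑ i, ∑ j, K (q i) (q' j)) :=
  h.sum measurable_pi_apply

variable [IsProbabilityMeasure μ] {P : Measure T} [IsProbabilityMeasure P] {B : T → ℝ}

lemma memLp_two_prod_tiltedDensity (h : IsGaussianField μ U K) (β : ℝ) {n : ℕ} (q : Fin n → T) :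
    MemLp (fun ω => ∏ i, tiltedDensity P (fun y => β * U y ω) (q i)) 2 μ := by
  simpa only [tiltedDensity_replicas] using
    (h.replicas (Fin n)).memLp_two_tiltedDensity (P := Measure.pi fun _ => P) β q

lemma ae_isProbabilityMeasure_tilted (h : IsGaussianField μ U K) (β : ℝ) :
    ∀ᵐ ω ∂μ, IsProbabilityMeasure (P.tilted fun y => β * U y ω) := by
  filter_upwards [h.ae_integrable_exp_abs (P := P)] with ω hω
  exact isProbabilityMeasure_tilted (integrable_exp_const_mul (h.measurable_realization ω) hω β)

lemma integral_mul_prod_tiltedDensity (h : IsGaussianField μ U K) (β : ℝ) {n : ℕ}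
    (q : Fin n → T) (k : Fin n) :
    ∫ ω, U (q k) ω * ∏ i, tiltedDensity P (fun y => β * U y ω) (q i) ∂μ =
      β * ∫ ω, (∏ i, tiltedDensity P (fun y => β * U y ω) (q i)) *
        (∑ i, K (q k) (q i) - n * ∫ y, K (q k) y ∂(P.tilted fun y => β * U y ω)) ∂μ := by
  have hn : (n : ℝ) ≠ 0 := Nat.cast_ne_zero.2 (Fin.pos k).ne'
  obtain ⟨v, hv⟩ := h.bounded
  have hK : Measurable (K (q k)) := h.measurable_covariance.comp measurable_prodMk_left
  have hmean : ∀ᵐ ω ∂μ, ∫ Y, ∑ _i : Fin n, ∑ j, K (q k) (Y j)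
      ∂((Measure.pi fun _ => P).tilted fun Y : Fin n → T => β * ∑ i, U (Y i) ω) =
        n * (n * ∫ y, K (q k) y ∂(P.tilted fun y => β * U y ω)) := by
    filter_upwards [h.ae_isProbabilityMeasure_tilted (P := P) β] with ω hω
    simp only [Finset.mul_sum]
    rw [← pi_tilted (fun _ => P) fun _ => (h.measurable_realization ω).const_mul β]
    simp only [Finset.sum_const, Finset.card_univ, Fintype.card_fin, nsmul_eq_mul,
      integral_const_mul]
    rw [integral_pi_sum_comp _ (.of_bound hK.aestronglyMeasurable v
      (.of_forall fun y => h.abs_covariance_le hv _ y)), Fintype.card_fin]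
  have key := (h.replicas (Fin n)).integral_mul_tiltedDensity
    (P := Measure.pi fun _ => P) β (fun _ => q k) q
  simp only [tiltedDensity_replicas] at key
  refine mul_left_cancel₀ hn ?_
  calc _ = _ := by rw [← integral_const_mul]; simp [mul_assoc]
    _ = _ := key
    _ = _ := by
      rw [mul_left_comm, ← integral_const_mul (n : ℝ)]
      congr 1
      refine integral_congr_ae ?_
      filter_upwards [hmean] with ω hω
      rw [hω]
      simp only [Finset.sum_const, Finset.card_univ, Fintype.card_fin, nsmul_eq_mul]
      ring

lemma integrable_prod_tiltedDensity_mul_covariance (h : IsGaussianField μ U K) (β : ℝ) {n : ℕ}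
    (q : Fin n → T) (k : Fin n) :
    Integrable (fun ω => (∏ i, tiltedDensity P (fun y => β * U y ω) (q i)) *
      (∑ i, K (q k) (q i) - n * ∫ y, K (q k) y ∂(P.tilted fun y => β * U y ω))) μ := by
  obtain ⟨v, hv⟩ := h.bounded
  have hK : Measurable (K (q k)) := h.measurable_covariance.comp measurable_prodMk_left
  refine ((h.memLp_two_prod_tiltedDensity β q).integrable one_le_two).mul_bdd (c := n * v + n * v)
    (measurable_const.sub ((h.measurable_integral_tilted β hK).const_mul _)).aestronglyMeasurable
    (.of_forall fun ω => (abs_sub _ _).trans (add_le_add ?_ ?_))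
  · simpa using (Finset.abs_sum_le_sum_abs (fun i => K (q k) (q i)) Finset.univ).trans
      (Finset.sum_le_sum fun i _ => h.abs_covariance_le hv (q k) (q i))
  · rw [abs_mul, Nat.abs_cast]
    gcongr
    exact abs_integral_tilted_le (h.abs_covariance_le hv (q k)) _

lemma integral_sub_mul_tiltedDensity (h : IsGaussianField μ U K) (β : ℝ) (x y : T) :
    ∫ ω, (U x ω - U y ω) * (tiltedDensity P (fun z => β * U z ω) x *
        tiltedDensity P (fun z => β * U z ω) y) ∂μ =
      β * ∫ ω, (tiltedDensity P (fun z => β * U z ω) x *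
          tiltedDensity P (fun z => β * U z ω) y) *
        (K x x - K y y - 2 * (∫ z, K x z ∂(P.tilted fun z => β * U z ω) -
          ∫ z, K y z ∂(P.tilted fun z => β * U z ω))) ∂μ := by
  have hW := h.memLp_two_prod_tiltedDensity (P := P) β ![x, y]
  have hUW : ∀ k, Integrable (fun ω => U (![x, y] k) ω *
      ∏ i, tiltedDensity P (fun z => β * U z ω) (![x, y] i)) μ :=
    fun k => (h.memLp_two _).integrable_mul hW
  have hWK := fun k => h.integrable_prod_tiltedDensity_mul_covariance (P := P) β ![x, y] k
  have hx := h.integral_mul_prod_tiltedDensity (P := P) β ![x, y] 0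
  have hy := h.integral_mul_prod_tiltedDensity (P := P) β ![x, y] 1
  have hsub := congrArg₂ HSub.hSub hx hy
  rw [← integral_sub (hUW 0) (hUW 1), ← mul_sub, ← integral_sub (hWK 0) (hWK 1)] at hsub
  simp only [Fin.prod_univ_two, Fin.sum_univ_two, Matrix.cons_val_zero, Matrix.cons_val_one]
    at hsub
  refine Eq.trans ?_ (hsub.trans ?_)
  · congr with ω; ring
  · congr with ω; rw [h.covariance_comm y x]; push_cast; ring

lemma integrable_mul_exp_abs_pair (h : IsGaussianField μ U K) (hB : Integrable B P) (c : ℝ) :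
    Integrable (fun p : Ω × T × T => B p.2.1 * (Real.exp (c * |U p.2.1 p.1|) +
      Real.exp (c * |U p.2.2 p.1|) + expMoment P (fun y => U y p.1) c)) (μ.prod (P.prod P)) := by
  have hB' : Integrable (fun q : T × T => B q.1) (P.prod P) := hB.comp_fst P
  simp only [mul_add]
  exact ((h.integrable_mul_exp_abs measurable_fst hB' c).add
    (h.integrable_mul_exp_abs measurable_snd hB' c)).add (h.integrable_mul_expMoment hB' c)

lemma integrable_mul_sub_mul_tiltedDensity (h : IsGaussianField μ U K) (hB : Integrable B P)
    (β : ℝ) :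
    Integrable (fun p : Ω × T × T => B p.2.1 * ((U p.2.1 p.1 - U p.2.2 p.1) *
      (tiltedDensity P (fun z => β * U z p.1) p.2.1 *
        tiltedDensity P (fun z => β * U z p.1) p.2.2))) (μ.prod (P.prod P)) := by
  refine (h.integrable_mul_exp_abs_pair hB.norm (4 * (|β| + 1))).mono' ?_ ?_
  · exact (hB.1.comp_fst.comp_snd).mul (((h.measurable.comp
      (measurable_snd.fst.prodMk measurable_fst)).sub (h.measurable.comp
        (measurable_snd.snd.prodMk measurable_fst))).mul
      (h.measurable_tiltedDensity_mul_tiltedDensity β)).aestronglyMeasurable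
  · filter_upwards [h.ae_prod_integrable_exp_abs (P := P) (P.prod P)] with p hp
    rw [norm_mul, norm_mul, Real.norm_eq_abs (_ - _), Real.norm_of_nonneg
      (mul_nonneg (tiltedDensity_nonneg _ _) (tiltedDensity_nonneg _ _))]
    exact mul_le_mul_of_nonneg_left (abs_sub_mul_tiltedDensity_le (h.measurable_realization p.1)
      hp le_rfl p.2.1 p.2.2) (norm_nonneg _)

lemma integrable_mul_tiltedDensity_mul_tiltedDensity (h : IsGaussianField μ U K)
    (hB : Integrable B P) (β : ℝ) :
    Integrable (fun p : Ω × T × T => B p.2.1 * (tiltedDensity P (fun z => β * U z p.1) p.2.1 *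
      tiltedDensity P (fun z => β * U z p.1) p.2.2)) (μ.prod (P.prod P)) := by
  refine (h.integrable_mul_exp_abs_pair hB.norm (4 * |β|)).mono'
    ((hB.1.comp_fst.comp_snd).mul
      (h.measurable_tiltedDensity_mul_tiltedDensity β).aestronglyMeasurable) ?_
  filter_upwards [h.ae_prod_integrable_exp_abs (P := P) (P.prod P)] with p hp
  rw [norm_mul, Real.norm_of_nonneg
    (mul_nonneg (tiltedDensity_nonneg _ _) (tiltedDensity_nonneg _ _))]
  refine mul_le_mul_of_nonneg_left ?_ (norm_nonneg _)
  have hsq := tiltedDensity_sq_le (h.measurable_realization p.1) hp (le_refl |β|)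
  nlinarith [two_mul_le_add_sq (tiltedDensity P (fun z => β * U z p.1) p.2.1)
    (tiltedDensity P (fun z => β * U z p.1) p.2.2), hsq p.2.1, hsq p.2.2,
    Real.exp_pos (4 * |β| * |U p.2.1 p.1|), Real.exp_pos (4 * |β| * |U p.2.2 p.1|)]

end IsGaussianField

/-- The mean of `K x x - K y y - 2 (K x z - K y z)` over a replica `z` distributed as `ν`: Gaussian
integration by parts turns the derivative of `tiltedMean` into an average of this kernel. -/
def covarianceGap {T : Type*} [MeasurableSpace T] (ν : Measure T) (K : T → T → ℝ) (x y : T) : ℝ :=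
  K x x - K y y - 2 * (∫ z, K x z ∂ν - ∫ z, K y z ∂ν)

namespace IsGaussianField

variable {T Ω : Type*} [MeasurableSpace T] [MeasurableSpace Ω] {μ : Measure Ω}
  {U : T → Ω → ℝ} {K : T → T → ℝ} [IsProbabilityMeasure μ]
  {P : Measure T} [IsProbabilityMeasure P] {B : T → ℝ}

lemma integrable_mul_tiltedDensity_mul_covarianceGap (h : IsGaussianField μ U K)
    (hB : Integrable B P) (β : ℝ) :
    Integrable (fun p : Ω × T × T => B p.2.1 * ((tiltedDensity P (fun z => β * U z p.1) p.2.1 *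
      tiltedDensity P (fun z => β * U z p.1) p.2.2) *
        covarianceGap (P.tilted fun z => β * U z p.1) K p.2.1 p.2.2)) (μ.prod (P.prod P)) := by
  obtain ⟨v, hv⟩ := h.bounded
  have hK := h.measurable_covariance
  have hmean : Measurable fun p : Ω × T => ∫ z, K p.2 z ∂(P.tilted fun z => β * U z p.1) := by
    simp only [integral_tilted_eq_tiltedDensity]
    refine measurable_integral_of_uncurry (A := fun z (p : Ω × T) => _ * K p.2 z) ?_
    exact ((h.measurable_tiltedDensity β).comp (measurable_snd.fst.prodMk measurable_fst)).mul
      (hK.comp (measurable_snd.snd.prodMk measurable_fst))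
  have hgap : Measurable fun p : Ω × T × T =>
      covarianceGap (P.tilted fun z => β * U z p.1) K p.2.1 p.2.2 :=
    ((hK.comp (measurable_snd.fst.prodMk measurable_snd.fst)).sub
      (hK.comp (measurable_snd.snd.prodMk measurable_snd.snd))).sub
      (((hmean.comp (measurable_fst.prodMk measurable_snd.fst)).sub
        (hmean.comp (measurable_fst.prodMk measurable_snd.snd))).const_mul 2)
  refine ((h.integrable_mul_tiltedDensity_mul_tiltedDensity hB β).mul_bdd (c := 6 * v)
    hgap.aestronglyMeasurable (.of_forall fun p => ?_)).congr (.of_forall fun p => mul_assoc _ _ _)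
  have hx := abs_le.1 (h.abs_covariance_le hv p.2.1 p.2.1)
  have hy := abs_le.1 (h.abs_covariance_le hv p.2.2 p.2.2)
  have hxz := abs_le.1 (abs_integral_tilted_le (P := P) (h.abs_covariance_le hv p.2.1)
    fun z => β * U z p.1)
  have hyz := abs_le.1 (abs_integral_tilted_le (P := P) (h.abs_covariance_le hv p.2.2)
    fun z => β * U z p.1)
  rw [covarianceGap, Real.norm_eq_abs, abs_le]
  constructor <;> linarith

lemma integral_sub_mul_tiltedDensity_prod (h : IsGaussianField μ U K) (hB : Integrable B P)
    (β : ℝ) :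
    ∫ p : Ω × T × T, B p.2.1 * ((U p.2.1 p.1 - U p.2.2 p.1) *
      (tiltedDensity P (fun z => β * U z p.1) p.2.1 *
        tiltedDensity P (fun z => β * U z p.1) p.2.2)) ∂(μ.prod (P.prod P)) =
    β * ∫ p : Ω × T × T, B p.2.1 * ((tiltedDensity P (fun z => β * U z p.1) p.2.1 *
      tiltedDensity P (fun z => β * U z p.1) p.2.2) *
        covarianceGap (P.tilted fun z => β * U z p.1) K p.2.1 p.2.2) ∂(μ.prod (P.prod P)) := by
  rw [integral_prod_symm _ (h.integrable_mul_sub_mul_tiltedDensity hB β),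
    integral_prod_symm _ (h.integrable_mul_tiltedDensity_mul_covarianceGap hB β),
    ← integral_const_mul]
  congr with q
  simp only [integral_const_mul]
  rw [h.integral_sub_mul_tiltedDensity, mul_left_comm]
  rfl

lemma integral_prod_tiltedDensity_mul_sub (h : IsGaussianField μ U K) (hB : Integrable B P)
    (β : ℝ) :
    ∫ p, B p.2 * (tiltedDensity P (fun y => β * U y p.1) p.2 *
      (U p.2 p.1 - ∫ y, U y p.1 ∂(P.tilted fun y => β * U y p.1))) ∂(μ.prod P) =
    ∫ p : Ω × T × T, B p.2.1 * ((U p.2.1 p.1 - U p.2.2 p.1) *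
      (tiltedDensity P (fun z => β * U z p.1) p.2.1 *
        tiltedDensity P (fun z => β * U z p.1) p.2.2)) ∂(μ.prod (P.prod P)) := by
  have hassoc := measurePreserving_prodAssoc μ P P
  have hi := (hassoc.integrable_comp_emb MeasurableEquiv.prodAssoc.measurableEmbedding).2
    (h.integrable_mul_sub_mul_tiltedDensity hB β)
  rw [← hassoc.integral_comp']
  refine Eq.trans ?_ (integral_prod _ hi).symm
  refine integral_congr_ae ?_
  filter_upwards [h.ae_prod_integrable_exp_abs (P := P) P] with p hp
  rw [tiltedDensity_mul_sub_integral (h.measurable_realization p.1) hp, ← integral_const_mul]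
  rfl

lemma integral_pi_covarianceGap (h : IsGaussianField μ U K) {ν : Measure T}
    [IsProbabilityMeasure ν] (hB : Integrable B ν) :
    ∫ q : Fin 3 → T, B (q 0) *
      (K (q 0) (q 0) - K (q 1) (q 1) - 2 * (K (q 0) (q 2) - K (q 1) (q 2)))
        ∂(Measure.pi fun _ => ν) = ∫ x, ∫ y, B x * covarianceGap ν K x y ∂ν ∂ν := by
  obtain ⟨v, hv⟩ := h.bounded
  have hK := h.measurable_covariance
  have hKi : ∀ x, Integrable (K x) ν := fun x =>
    .of_bound (hK.comp measurable_prodMk_left).aestronglyMeasurable v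
      (.of_forall (h.abs_covariance_le hv x))
  have hKq : ∀ i j, Measurable fun q : Fin 3 → T => K (q i) (q j) := fun i j =>
    hK.comp (f := fun q : Fin 3 → T => (q i, q j)) (by fun_prop)
  rw [integral_pi_fin_three ν (f := fun x y z => B x * (K x x - K y y - 2 * (K x z - K y z)))]
  · congr! with x y
    have hd : Integrable (fun z => 2 * (K x z - K y z)) ν := ((hKi x).sub (hKi y)).const_mul 2
    rw [integral_const_mul, integral_sub (integrable_const _) hd, integral_const_mul,
      integral_sub (hKi x) (hKi y), integral_const, probReal_univ, one_smul]
    rfl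
  · refine (integrable_comp_eval (μ := fun _ => ν) hB).mul_bdd (c := 6 * v)
      (((hKq 0 0).sub (hKq 1 1)).sub
        (((hKq 0 2).sub (hKq 1 2)).const_mul 2)).aestronglyMeasurable (.of_forall fun q => ?_)
    rw [Real.norm_eq_abs, abs_le]
    constructor <;>
      linarith [abs_le.1 (h.abs_covariance_le hv (q 0) (q 0)),
        abs_le.1 (h.abs_covariance_le hv (q 1) (q 1)),
        abs_le.1 (h.abs_covariance_le hv (q 0) (q 2)),
        abs_le.1 (h.abs_covariance_le hv (q 1) (q 2))]

lemma ae_integrable_tilted (h : IsGaussianField μ U K) (hB : Integrable B P) (β : ℝ) :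
    ∀ᵐ ω ∂μ, Integrable B (P.tilted fun y => β * U y ω) := by
  filter_upwards [(h.integrable_mul_tiltedDensity hB β).prod_right_ae,
    h.ae_integrable_exp_abs (P := P)] with ω hω hexp
  have hint := integrable_exp_const_mul (h.measurable_realization ω) hexp β
  refine (integrable_tilted_iff hint _).2 ((hω.mul_const (∫ y, Real.exp (β * U y ω) ∂P)).congr
    (.of_forall fun x => ?_))
  have := (integral_exp_pos hint).ne'
  simp only [tiltedDensity, smul_eq_mul]
  field_simp

lemma integral_prod_covarianceGap (h : IsGaussianField μ U K) (hB : Integrable B P) (β : ℝ) :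
    ∫ p : Ω × T × T, B p.2.1 * ((tiltedDensity P (fun z => β * U z p.1) p.2.1 *
      tiltedDensity P (fun z => β * U z p.1) p.2.2) *
        covarianceGap (P.tilted fun z => β * U z p.1) K p.2.1 p.2.2) ∂(μ.prod (P.prod P)) =
    ∫ ω, ∫ q : Fin 3 → T, B (q 0) *
      (K (q 0) (q 0) - K (q 1) (q 1) - 2 * (K (q 0) (q 2) - K (q 1) (q 2)))
        ∂(Measure.pi fun _ => P.tilted fun y => β * U y ω) ∂μ := by
  have hi := h.integrable_mul_tiltedDensity_mul_covarianceGap hB β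
  rw [integral_prod _ hi]
  refine integral_congr_ae ?_
  filter_upwards [hi.prod_right_ae, h.ae_integrable_tilted hB β,
    h.ae_isProbabilityMeasure_tilted (P := P) β] with ω hω hBω _
  rw [integral_pi_covarianceGap h hBω, integral_prod _ hω, integral_tilted_eq_tiltedDensity]
  congr with x
  rw [integral_tilted_eq_tiltedDensity, ← integral_const_mul]
  congr with y
  ring

theorem hasDerivAt_tiltedMean (h : IsGaussianField μ U K) (hB : Integrable B P) (β : ℝ) :
    HasDerivAt (fun b => tiltedMean μ U P b B)
      (β * ∫ ω, ∫ q : Fin 3 → T, B (q 0) *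
        (K (q 0) (q 0) - K (q 1) (q 1) - 2 * (K (q 0) (q 2) - K (q 1) (q 2)))
          ∂(Measure.pi fun _ => P.tilted fun y => β * U y ω) ∂μ) β := by
  rw [← h.integral_prod_covarianceGap hB, ← h.integral_sub_mul_tiltedDensity_prod hB,
    ← h.integral_prod_tiltedDensity_mul_sub hB]
  exact h.hasDerivAt_tiltedMean_prod hB β

end IsGaussianField

section ReplicaMean

variable {S Ω ι κ : Type*} [MeasurableSpace S] [MeasurableSpace Ω] [Fintype ι] [Fintype κ]
  {μ : Measure Ω} {U : S → Ω → ℝ} {K : S → S → ℝ} {P : ι → Measure S} {B : (ι → S) → ℝ} {β : ℝ}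

/-- The mean of `B` over independent paths `X i`, each distributed as the tilting of `P i` by the
common field `β U`, averaged over the field. -/
def replicaMean (μ : Measure Ω) (U : S → Ω → ℝ) (P : ι → Measure S) (β : ℝ)
    (B : (ι → S) → ℝ) : ℝ :=
  ∫ ω, ∫ X, B X ∂(Measure.pi fun i => (P i).tilted fun x => β * U x ω) ∂μ

/-- The kernel whose average over three independent layers of paths is the derivative of a
`replicaMean`; layer `0` is the one carrying the observable. -/
def replicaGap (K : S → S → ℝ) (X : Fin 3 × ι → S) : ℝ :=
  ∑ i, ∑ j, (K (X (0, i)) (X (0, j)) - K (X (1, i)) (X (1, j)) -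
    2 * (K (X (0, i)) (X (2, j)) - K (X (1, i)) (X (2, j))))

lemma replicaMean_const_mul (c β : ℝ) (B : (ι → S) → ℝ) :
    replicaMean μ U P β (fun X => c * B X) = c * replicaMean μ U P β B := by
  simp only [replicaMean, integral_const_mul]

lemma replicaMean_nonneg (hB : ∀ X, 0 ≤ B X) (β : ℝ) : 0 ≤ replicaMean μ U P β B :=
  integral_nonneg fun _ => integral_nonneg hB

variable [∀ i, IsProbabilityMeasure (P i)]

lemma pi_tilted_mul (hU : Measurable (Function.uncurry U)) (β : ℝ) (ω : Ω) :
    Measure.pi (fun i => (P i).tilted fun x => β * U x ω) =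
      (Measure.pi P).tilted fun X => β * ∑ i, U (X i) ω := by
  simp only [Finset.mul_sum]
  exact pi_tilted P fun _ => (hU.comp measurable_prodMk_right).const_mul β

namespace IsGaussianField

variable (h : IsGaussianField μ U K)
include h

lemma replicaMean_eq_tiltedMean (β : ℝ) (B : (ι → S) → ℝ) :
    replicaMean μ U P β B =
      tiltedMean μ (fun (X : ι → S) ω => ∑ i, U (X i) ω) (Measure.pi P) β B := by
  simp only [replicaMean, tiltedMean, pi_tilted_mul h.measurable]

variable [IsProbabilityMeasure μ]

lemma measurable_replicaGap : Measurable (replicaGap K : (Fin 3 × ι → S) → ℝ) := by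
  have hK := h.measurable_covariance
  unfold replicaGap
  fun_prop

lemma hasDerivAt_replicaMean (hBm : Measurable B) (hB : Integrable B (Measure.pi P)) (β : ℝ) :
    HasDerivAt (fun b => replicaMean μ U P b B)
      (β * replicaMean μ U (fun p : Fin 3 × ι => P p.2) β fun X =>
        B (fun i => X (0, i)) * replicaGap K X) β := by
  simp only [h.replicaMean_eq_tiltedMean (P := P)]
  convert (h.replicas ι).hasDerivAt_tiltedMean hB β using 2
  refine integral_congr_ae ?_
  filter_upwards [ae_all_iff.2 fun i => h.ae_isProbabilityMeasure_tilted (P := P i) β] with ω hω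
  have hp := measurePreserving_uncurry (κ := Fin 3) fun i => (P i).tilted fun x => β * U x ω
  rw [← pi_tilted_mul h.measurable, ← hp.map_eq, integral_map hp.aemeasurable]
  · simp only [replicaGap, Finset.sum_sub_distrib, ← Finset.mul_sum]
  · refine (Measurable.mul ?_ h.measurable_replicaGap).aestronglyMeasurable
    fun_prop

lemma continuous_replicaMean (hBm : Measurable B) (hB : Integrable B (Measure.pi P)) :
    Continuous fun b => replicaMean μ U P b B :=
  continuous_iff_continuousAt.2 fun β => (h.hasDerivAt_replicaMean hBm hB β).continuousAt

lemma replicaMean_comp (hBm : Measurable B) {f : ι → κ} (hf : Function.Injective f)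
    {P : κ → Measure S} [∀ k, IsProbabilityMeasure (P k)] (β : ℝ) :
    replicaMean μ U (fun i => P (f i)) β B =
      replicaMean μ U P β fun X => B fun i => X (f i) := by
  refine integral_congr_ae ?_
  filter_upwards [ae_all_iff.2 fun k => h.ae_isProbabilityMeasure_tilted (P := P k) β] with ω hω
  have hp := measurePreserving_comp_pi (fun k => (P k).tilted fun x => β * U x ω) hf
  rw [← hp.map_eq, integral_map hp.aemeasurable hBm.aestronglyMeasurable]

lemma replicaMean_mono {C : (ι → S) → ℝ} (hB : Integrable B (Measure.pi P))
    (hC : Integrable C (Measure.pi P)) (hBC : ∀ X, B X ≤ C X) (β : ℝ) :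
    replicaMean μ U P β B ≤ replicaMean μ U P β C := by
  simp only [h.replicaMean_eq_tiltedMean, (h.replicas ι).tiltedMean_eq_integral_prod hB,
    (h.replicas ι).tiltedMean_eq_integral_prod hC]
  exact integral_mono ((h.replicas ι).integrable_mul_tiltedDensity hB β)
    ((h.replicas ι).integrable_mul_tiltedDensity hC β) fun p =>
      mul_le_mul_of_nonneg_right (hBC p.2) (tiltedDensity_nonneg _ _)

lemma abs_replicaMean_le {C : (ι → S) → ℝ} (hB : Integrable B (Measure.pi P))
    (hC : Integrable C (Measure.pi P)) (hBC : ∀ X, |B X| ≤ C X) (β : ℝ) :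
    |replicaMean μ U P β B| ≤ replicaMean μ U P β C := by
  have hneg := h.replicaMean_mono (hC.const_mul (-1)) hB
    (fun X => by linarith [(abs_le.1 (hBC X)).1]) β
  rw [replicaMean_const_mul, neg_one_mul] at hneg
  exact abs_le.2 ⟨hneg, h.replicaMean_mono hB hC (fun X => (abs_le.1 (hBC X)).2) β⟩

lemma replicaMean_add {C : (ι → S) → ℝ} (hB : Integrable B (Measure.pi P))
    (hC : Integrable C (Measure.pi P)) (β : ℝ) :
    replicaMean μ U P β (fun X => B X + C X) =
      replicaMean μ U P β B + replicaMean μ U P β C := by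
  have hBC : Integrable (fun X => B X + C X) (Measure.pi P) := hB.add hC
  simp only [h.replicaMean_eq_tiltedMean]
  rw [(h.replicas ι).tiltedMean_eq_integral_prod hBC,
    (h.replicas ι).tiltedMean_eq_integral_prod hB, (h.replicas ι).tiltedMean_eq_integral_prod hC]
  simp only [add_mul]
  exact integral_add ((h.replicas ι).integrable_mul_tiltedDensity hB β)
    ((h.replicas ι).integrable_mul_tiltedDensity hC β)

lemma replicaMean_sum {α : Type*} {s : Finset α} {B : α → (ι → S) → ℝ}
    (hB : ∀ a ∈ s, Integrable (B a) (Measure.pi P)) (β : ℝ) :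
    replicaMean μ U P β (fun X => ∑ a ∈ s, B a X) = ∑ a ∈ s, replicaMean μ U P β (B a) := by
  simp only [h.replicaMean_eq_tiltedMean]
  rw [(h.replicas ι).tiltedMean_eq_integral_prod (integrable_finsetSum s hB),
    Finset.sum_congr rfl fun a ha => (h.replicas ι).tiltedMean_eq_integral_prod (hB a ha) β]
  simp only [Finset.sum_mul]
  exact integral_finsetSum s fun a ha => (h.replicas ι).integrable_mul_tiltedDensity (hB a ha) β

end IsGaussianField

end ReplicaMean

section Overlap

lemma rpow_mul_le_add {x y r : ℝ} (hx : 0 ≤ x) (hy : 0 ≤ y) (hr : 0 ≤ r) :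
    x ^ r * y ≤ x ^ (r + 1) + y ^ (r + 1) := by
  have hsucc : ∀ z : ℝ, 0 ≤ z → z ^ (r + 1) = z ^ r * z := fun z hz => by
    rw [Real.rpow_add_of_nonneg hz hr zero_le_one, Real.rpow_one]
  have hmax : x ^ r * y ≤ max x y ^ (r + 1) := by
    rw [hsucc _ (hx.trans (le_max_left x y))]
    gcongr
    exacts [le_max_left x y, le_max_right x y]
  refine hmax.trans ?_
  rcases max_choice x y with h | h <;> rw [h]
  · exact le_add_of_nonneg_right (by positivity)
  · exact le_add_of_nonneg_left (by positivity)

lemma exists_injective_fin_three {L : Type*} [Fintype L] (hL : 3 ≤ Fintype.card L) (x y z : L) :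
    ∃ f : Fin 3 → L, Function.Injective f ∧ f 0 = x ∧ y ∈ range f ∧ z ∈ range f := by
  classical
  obtain ⟨u, hxyz, hu⟩ := Finset.exists_superset_card_eq (s := {x, y, z}) Finset.card_le_three hL
  have hx : x ∈ u := hxyz (by simp)
  let e : Fin 3 ≃ u := (u.equivFinOfCardEq hu).symm
  let f : Fin 3 ≃ u := (Equiv.swap 0 (e.symm ⟨x, hx⟩)).trans e
  have hrange : ∀ w ∈ u, w ∈ range fun i => (f i : L) := fun w hw =>
    ⟨f.symm ⟨w, hw⟩, by simp only [Equiv.apply_symm_apply]⟩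
  refine ⟨fun i => f i, Subtype.val_injective.comp f.injective, ?_,
    hrange y (hxyz (by simp)), hrange z (hxyz (by simp))⟩
  simp [f]

variable {S ι κ : Type*} {K : S → S → ℝ} {r : ℝ}

/-- `Q[X_l] K(X_a, X_b)^r`, where the paths `X_l` are those with index in the range of `l`. -/
def weightedOverlap (K : S → S → ℝ) (Q : (κ → S) → ℝ) (r : ℝ) (l : κ → ι) (a b : ι)
    (X : ι → S) : ℝ :=
  Q (fun j => X (l j)) * K (X a) (X b) ^ r

lemma weightedOverlap_nonneg {Q : (κ → S) → ℝ} (hK0 : ∀ x y, 0 ≤ K x y) (hQ0 : ∀ X, 0 ≤ Q X)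
    (r : ℝ) (l : κ → ι) (a b : ι) (X : ι → S) : 0 ≤ weightedOverlap K Q r l a b X :=
  mul_nonneg (hQ0 _) (Real.rpow_nonneg (hK0 _ _) r)

variable [Fintype ι] [DecidableEq ι] {v : ℝ}

lemma abs_replicaGap_le (hK0 : ∀ x y, 0 ≤ K x y) (hKv : ∀ x, K x x = v)
    (X : Fin 3 × ι → S) :
    |replicaGap K X| ≤ 2 * ∑ e : (Fin 3 × ι) × (Fin 3 × ι) with e.1 ≠ e.2, K (X e.1) (X e.2) := by
  let m : Fin 3 × ι → Fin 3 × ι → ℝ := fun a b => if a ≠ b then K (X a) (X b) else 0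
  have hm : ∀ a b, 0 ≤ m a b := fun a b => ite_nonneg (hK0 _ _) le_rfl
  have hgap : ∀ i j, K (X (0, i)) (X (0, j)) - K (X (1, i)) (X (1, j)) -
      2 * (K (X (0, i)) (X (2, j)) - K (X (1, i)) (X (2, j))) =
      m (0, i) (0, j) - m (1, i) (1, j) - 2 * (m (0, i) (2, j) - m (1, i) (2, j)) := fun i j => by
    rcases eq_or_ne i j with rfl | hij
    · simp [m, hKv]
    · simp [m, hij]
  have hsum : ∑ e : (Fin 3 × ι) × (Fin 3 × ι) with e.1 ≠ e.2, K (X e.1) (X e.2) =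
      ∑ i, ∑ j, ∑ α, ∑ γ, m (α, i) (γ, j) := by
    rw [Finset.sum_filter, Fintype.sum_prod_type]
    simp only [Fintype.sum_prod_type_right]
    refine Finset.sum_congr rfl fun i _ => ?_
    rw [Finset.sum_comm]
  rw [hsum, replicaGap, Finset.mul_sum]
  refine (Finset.abs_sum_le_sum_abs _ _).trans (Finset.sum_le_sum fun i _ => ?_)
  rw [Finset.mul_sum]
  refine (Finset.abs_sum_le_sum_abs _ _).trans (Finset.sum_le_sum fun j _ => ?_)
  simp only [hgap, Fin.sum_univ_three, abs_le]
  constructor <;> linarith [hm (0, i) (0, j), hm (0, i) (1, j), hm (0, i) (2, j),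
    hm (1, i) (0, j), hm (1, i) (1, j), hm (1, i) (2, j), hm (2, i) (0, j), hm (2, i) (1, j),
    hm (2, i) (2, j)]

lemma abs_weightedOverlap_mul_replicaGap_le (hK0 : ∀ x y, 0 ≤ K x y)
    (hKv : ∀ x, K x x = v) (hr : 0 ≤ r) (Q : (κ → S) → ℝ) (l : κ → ι) (a b : ι)
    (X : Fin 3 × ι → S) :
    |weightedOverlap K Q r l a b (fun i => X (0, i)) * replicaGap K X| ≤
      2 * ∑ e : (Fin 3 × ι) × (Fin 3 × ι) with e.1 ≠ e.2,
        (weightedOverlap K (fun Y => |Q Y|) (r + 1) (fun j => (0, l j)) (0, a) (0, b) X +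
          weightedOverlap K (fun Y => |Q Y|) (r + 1) (fun j => (0, l j)) e.1 e.2 X) := by
  set q : ℝ := |Q fun j => X (0, l j)| with hq
  have hpow := Real.rpow_nonneg (hK0 (X (0, a)) (X (0, b))) r
  have habs : |weightedOverlap K Q r l a b fun i => X (0, i)| =
      q * K (X (0, a)) (X (0, b)) ^ r := by
    rw [weightedOverlap, abs_mul, abs_of_nonneg hpow]
  rw [abs_mul, habs]
  refine (mul_le_mul_of_nonneg_left (abs_replicaGap_le hK0 hKv X) (by positivity)).trans ?_
  rw [mul_left_comm, Finset.mul_sum]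
  refine mul_le_mul_of_nonneg_left (Finset.sum_le_sum fun e _ => ?_) zero_le_two
  simp only [weightedOverlap, ← hq, ← mul_add, mul_assoc]
  exact mul_le_mul_of_nonneg_left (rpow_mul_le_add (hK0 _ _) (hK0 _ _) hr) (abs_nonneg _)

end Overlap

section OverlapSum

variable {S Ω ι κ : Type*} [MeasurableSpace S] [MeasurableSpace Ω]
  {μ : Measure Ω} {U : S → Ω → ℝ} {K : S → S → ℝ} {P : κ → Measure S} {Q : (κ → S) → ℝ}
  {r : ℝ} {v : ℝ≥0}

lemma card_distinct_pairs_le (κ : Type*) [Fintype κ] [DecidableEq κ] :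
    ((Finset.univ.filter fun e : (Fin 3 × κ) × (Fin 3 × κ) => e.1 ≠ e.2).card : ℝ) ≤
      9 * Fintype.card κ ^ 2 := by
  refine (Nat.cast_le.2 (Finset.card_le_univ _)).trans_eq ?_
  simp only [Fintype.card_prod, Fintype.card_fin]
  push_cast
  ring

lemma IsGaussianField.measurable_weightedOverlap [SFinite μ] (h : IsGaussianField μ U K)
    (hQ : Measurable Q) (r : ℝ) (l : κ → ι) (a b : ι) :
    Measurable (weightedOverlap K Q r l a b) := by
  have hK := h.measurable_covariance
  unfold weightedOverlap
  fun_prop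

variable [Fintype κ]

/-- The sum `∑_{a ≠ b} E Ê (Q[X₀] K(X_a, X_b)^r)` over pairs of paths from three layers, all paths
being independent under the tilting by `β U`. -/
def overlapSum [DecidableEq κ] (μ : Measure Ω) (U : S → Ω → ℝ) (K : S → S → ℝ)
    (P : κ → Measure S) (r : ℝ) (Q : (κ → S) → ℝ) (β : ℝ) : ℝ :=
  ∑ e : (Fin 3 × κ) × (Fin 3 × κ) with e.1 ≠ e.2,
    replicaMean μ U (fun p => P p.2) β (weightedOverlap K Q r (Prod.mk 0) e.1 e.2)

lemma overlapSum_nonneg [DecidableEq κ] (hK0 : ∀ x y, 0 ≤ K x y) (hQ0 : ∀ X, 0 ≤ Q X) (r β : ℝ) :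
    0 ≤ overlapSum μ U K P r Q β :=
  Finset.sum_nonneg fun _ _ =>
    replicaMean_nonneg (weightedOverlap_nonneg hK0 hQ0 r _ _ _) β

namespace IsGaussianField

variable [IsProbabilityMeasure μ]

lemma integrable_weightedOverlap [Fintype ι] (h : IsGaussianField μ U K) (hK0 : ∀ x y, 0 ≤ K x y)
    {P : ι → Measure S} [∀ i, IsProbabilityMeasure (P i)] {l : κ → ι} (hl : Function.Injective l)
    (hQ : Integrable Q (Measure.pi fun j => P (l j))) (hr : 0 ≤ r) (a b : ι) :
    Integrable (weightedOverlap K Q r l a b) (Measure.pi P) := by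
  obtain ⟨v, hv⟩ := h.bounded
  have hK := h.measurable_covariance
  refine ((measurePreserving_comp_pi P hl).integrable_comp_of_integrable hQ).mul_bdd (c := v ^ r)
    (Measurable.aestronglyMeasurable (by fun_prop)) (.of_forall fun X => ?_)
  rw [Real.norm_of_nonneg (Real.rpow_nonneg (hK0 _ _) r)]
  exact Real.rpow_le_rpow (hK0 _ _) ((le_abs_self _).trans (h.abs_covariance_le hv _ _)) hr

variable [∀ k, IsProbabilityMeasure (P k)]

lemma integrable_weightedOverlap_layer (h : IsGaussianField μ U K) (hK0 : ∀ x y, 0 ≤ K x y)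
    (hQ : Integrable Q (Measure.pi P)) (hr : 0 ≤ r) (a b : Fin 3 × κ) :
    Integrable (weightedOverlap K Q r (Prod.mk 0) a b)
      (Measure.pi fun p : Fin 3 × κ => P p.2) :=
  h.integrable_weightedOverlap hK0 (Prod.mk_right_injective 0) hQ hr a b

variable [DecidableEq κ]

lemma overlapSum_le_abs (h : IsGaussianField μ U K) (hK0 : ∀ x y, 0 ≤ K x y)
    (hQ : Integrable Q (Measure.pi P)) (hr : 0 ≤ r) (β : ℝ) :
    overlapSum μ U K P r Q β ≤ overlapSum μ U K P r (fun X => |Q X|) β :=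
  Finset.sum_le_sum fun _ _ => h.replicaMean_mono
    (h.integrable_weightedOverlap_layer hK0 hQ hr _ _)
    (h.integrable_weightedOverlap_layer hK0 hQ.abs hr _ _)
    (fun _ => mul_le_mul_of_nonneg_right (le_abs_self _) (Real.rpow_nonneg (hK0 _ _) r)) β

lemma overlapSum_le (h : IsGaussianField μ U K) (hK0 : ∀ x y, 0 ≤ K x y) (hKv : ∀ x, K x x ≤ v)
    (hQm : Measurable Q) (hQ : Integrable Q (Measure.pi P)) (hQ0 : ∀ X, 0 ≤ Q X) (hr : 0 ≤ r)
    (β : ℝ) :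
    overlapSum μ U K P r Q β ≤ 9 * Fintype.card κ ^ 2 * replicaMean μ U P β Q * v ^ r := by
  have hterm : ∀ e ∈ Finset.univ.filter fun e : (Fin 3 × κ) × (Fin 3 × κ) => e.1 ≠ e.2,
      replicaMean μ U (fun p => P p.2) β (weightedOverlap K Q r (Prod.mk 0) e.1 e.2) ≤
        v ^ r * replicaMean μ U P β Q := fun e _ => by
    have hf : Function.Injective (Prod.mk (0 : Fin 3) : κ → Fin 3 × κ) :=
      Prod.mk_right_injective 0
    rw [h.replicaMean_comp (P := fun p : Fin 3 × κ => P p.2) hQm hf, ← replicaMean_const_mul]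
    have hQ' : Integrable (fun X : Fin 3 × κ → S => Q fun j => X (0, j))
        (Measure.pi fun p => P p.2) :=
      (measurePreserving_comp_pi (fun p : Fin 3 × κ => P p.2) hf).integrable_comp_of_integrable hQ
    refine h.replicaMean_mono (h.integrable_weightedOverlap_layer hK0 hQ hr _ _)
      (hQ'.const_mul _) (fun X => ?_) β
    exact (mul_comm _ _).trans_le (mul_le_mul_of_nonneg_right (Real.rpow_le_rpow (hK0 _ _)
      ((le_abs_self _).trans (h.abs_covariance_le hKv _ _)) hr) (hQ0 _))
  refine (Finset.sum_le_sum hterm).trans ?_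
  have hmean : 0 ≤ replicaMean μ U P β Q := replicaMean_nonneg hQ0 β
  rw [Finset.sum_const, nsmul_eq_mul, mul_assoc _ _ ((v : ℝ) ^ r), mul_comm _ ((v : ℝ) ^ r)]
  gcongr
  exact card_distinct_pairs_le κ

/-- Only three of the nine layers of paths enter the overlap, so they can be relabelled as the
layers of `overlapSum`. -/
lemma replicaMean_weightedOverlap_le (h : IsGaussianField μ U K) (hK0 : ∀ x y, 0 ≤ K x y)
    (hQ : Measurable Q) (hQ0 : ∀ X, 0 ≤ Q X) (r β : ℝ) {a b : Fin 3 × Fin 3 × κ} (hab : a ≠ b) :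
    replicaMean μ U (fun p : Fin 3 × Fin 3 × κ => P p.2.2) β
        (weightedOverlap K Q r (fun j => (0, 0, j)) a b) ≤ overlapSum μ U K P r Q β := by
  obtain ⟨f, hf, hf0, ⟨i, hi⟩, ⟨j, hj⟩⟩ :=
    exists_injective_fin_three (by simp) ((0, 0) : Fin 3 × Fin 3) (a.1, a.2.1) (b.1, b.2.1)
  let g : Fin 3 × κ → Fin 3 × Fin 3 × κ := fun p => ((f p.1).1, (f p.1).2, p.2)
  have hg : Function.Injective g := fun p q hpq => by
    simp only [g, Prod.mk.injEq] at hpq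
    exact Prod.ext (hf (Prod.ext hpq.1 hpq.2.1)) hpq.2.2
  have ha : g (i, a.2.2) = a := by simp [g, hi]
  have hb : g (j, b.2.2) = b := by simp [g, hj]
  have h0 : ∀ k, g (0, k) = (0, 0, k) := fun k => by simp [g, hf0]
  have hne : (i, a.2.2) ≠ (j, b.2.2) := fun hij => hab (ha ▸ hb ▸ congrArg g hij)
  have hrelabel := h.replicaMean_comp (P := fun p : Fin 3 × Fin 3 × κ => P p.2.2)
    (h.measurable_weightedOverlap hQ r (Prod.mk 0) (i, a.2.2) (j, b.2.2)) hg β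
  simp only [weightedOverlap, ha, hb, h0] at hrelabel
  refine hrelabel.symm.trans_le ?_
  exact Finset.single_le_sum (f := fun e : (Fin 3 × κ) × (Fin 3 × κ) =>
    replicaMean μ U (fun p : Fin 3 × κ => P p.2) β (weightedOverlap K Q r (Prod.mk 0) e.1 e.2))
    (fun e _ => replicaMean_nonneg (weightedOverlap_nonneg hK0 hQ0 r _ _ _) β)
    (Finset.mem_filter.2 ⟨Finset.mem_univ ((i, a.2.2), (j, b.2.2)), hne⟩)

end IsGaussianField

end OverlapSum

section OverlapDerivative

variable {S Ω κ : Type*} [MeasurableSpace S] [MeasurableSpace Ω] [Fintype κ]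
  {μ : Measure Ω} {U : S → Ω → ℝ} {K : S → S → ℝ} {P : κ → Measure S} {Q : (κ → S) → ℝ}
  {r v : ℝ}

/-- The derivative of `overlapSum` is `β` times this quantity, which involves nine layers of paths:
three copies of the three layers of `overlapSum`. -/
def overlapSlope [DecidableEq κ] (μ : Measure Ω) (U : S → Ω → ℝ) (K : S → S → ℝ) (P : κ → Measure S)
    (r : ℝ) (Q : (κ → S) → ℝ) (β : ℝ) : ℝ :=
  ∑ e : (Fin 3 × κ) × (Fin 3 × κ) with e.1 ≠ e.2,
    replicaMean μ U (fun p : Fin 3 × Fin 3 × κ => P p.2.2) β fun X =>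
      weightedOverlap K Q r (Prod.mk 0) e.1 e.2 (fun i => X (0, i)) * replicaGap K X

namespace IsGaussianField

variable [IsProbabilityMeasure μ] [∀ k, IsProbabilityMeasure (P k)]

lemma integrable_weightedOverlap_mul_replicaGap (h : IsGaussianField μ U K)
    (hK0 : ∀ x y, 0 ≤ K x y) (hKv : ∀ x, K x x = v) (hQ : Integrable Q (Measure.pi P))
    (hr : 0 ≤ r) (a b : Fin 3 × κ) :
    Integrable (fun X : Fin 3 × Fin 3 × κ → S =>
      weightedOverlap K Q r (Prod.mk 0) a b (fun i => X (0, i)) * replicaGap K X)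
      (Measure.pi fun p => P p.2.2) := by
  classical
  refine ((measurePreserving_comp_pi (fun p : Fin 3 × Fin 3 × κ => P p.2.2)
    (Prod.mk_right_injective 0)).integrable_comp_of_integrable
      (h.integrable_weightedOverlap_layer hK0 hQ hr a b)).mul_bdd
    (c := 2 * ∑ e : (Fin 3 × Fin 3 × κ) × (Fin 3 × Fin 3 × κ) with e.1 ≠ e.2, v)
    h.measurable_replicaGap.aestronglyMeasurable (.of_forall fun X => ?_)
  refine (abs_replicaGap_le hK0 hKv X).trans ?_
  gcongr
  exact (le_abs_self _).trans (h.abs_covariance_le (fun x => (hKv x).le) _ _)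

variable [DecidableEq κ]

lemma hasDerivAt_overlapSum (h : IsGaussianField μ U K) (hK0 : ∀ x y, 0 ≤ K x y)
    (hQm : Measurable Q) (hQ : Integrable Q (Measure.pi P)) (hr : 0 ≤ r) (β : ℝ) :
    HasDerivAt (overlapSum μ U K P r Q) (β * overlapSlope μ U K P r Q β) β := by
  rw [overlapSlope, Finset.mul_sum]
  exact HasDerivAt.fun_sum fun e _ => h.hasDerivAt_replicaMean
    (h.measurable_weightedOverlap hQm r (Prod.mk 0) e.1 e.2)
    (h.integrable_weightedOverlap_layer hK0 hQ hr e.1 e.2) β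

lemma continuous_overlapSlope (h : IsGaussianField μ U K) (hK0 : ∀ x y, 0 ≤ K x y)
    (hKv : ∀ x, K x x = v) (hQm : Measurable Q) (hQ : Integrable Q (Measure.pi P)) (hr : 0 ≤ r) :
    Continuous (overlapSlope μ U K P r Q) := by
  refine continuous_finsetSum _ fun e _ => h.continuous_replicaMean ?_
    (h.integrable_weightedOverlap_mul_replicaGap hK0 hKv hQ hr e.1 e.2)
  have hw := h.measurable_weightedOverlap hQm r (Prod.mk 0) e.1 e.2
  exact (hw.comp (by fun_prop)).mul h.measurable_replicaGap

lemma abs_replicaMean_mul_replicaGap_le (h : IsGaussianField μ U K) (hK0 : ∀ x y, 0 ≤ K x y)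
    (hKv : ∀ x, K x x = v) (hQm : Measurable Q) (hQ : Integrable Q (Measure.pi P)) (hr : 0 ≤ r)
    (β : ℝ) {a b : Fin 3 × κ} (hab : a ≠ b) :
    |replicaMean μ U (fun p : Fin 3 × Fin 3 × κ => P p.2.2) β fun X =>
        weightedOverlap K Q r (Prod.mk 0) a b (fun i => X (0, i)) * replicaGap K X| ≤
      324 * Fintype.card κ ^ 2 * overlapSum μ U K P (r + 1) (fun X => |Q X|) β := by
  set o := overlapSum μ U K P (r + 1) (fun X => |Q X|) β
  set w : Fin 3 × Fin 3 × κ → Fin 3 × Fin 3 × κ → (Fin 3 × Fin 3 × κ → S) → ℝ :=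
    weightedOverlap K (fun Y => |Q Y|) (r + 1) (fun j => (0, 0, j))
  have hw : ∀ c d, Integrable (w c d) (Measure.pi fun p : Fin 3 × Fin 3 × κ => P p.2.2) :=
    fun c d => h.integrable_weightedOverlap hK0
      ((Prod.mk_right_injective 0).comp (Prod.mk_right_injective 0)) hQ.abs (by positivity) c d
  have ho : ∀ {c d}, c ≠ d →
      replicaMean μ U (fun p : Fin 3 × Fin 3 × κ => P p.2.2) β (w c d) ≤ o := fun hcd =>
    h.replicaMean_weightedOverlap_le hK0 hQm.abs (fun _ => abs_nonneg _) (r + 1) β hcd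
  have ho0 : 0 ≤ o := overlapSum_nonneg hK0 (fun _ => abs_nonneg _) (r + 1) β
  have hne : ((0 : Fin 3), a) ≠ (0, b) := fun he => hab (congrArg Prod.snd he)
  have hsum := fun e : (Fin 3 × Fin 3 × κ) × (Fin 3 × Fin 3 × κ) =>
    (hw (0, a) (0, b)).add (hw e.1 e.2)
  refine (h.abs_replicaMean_le (h.integrable_weightedOverlap_mul_replicaGap hK0 hKv hQ hr a b)
    ((integrable_finsetSum _ fun e _ => hsum e).const_mul 2)
    (abs_weightedOverlap_mul_replicaGap_le hK0 hKv hr Q (Prod.mk 0) a b) β).trans ?_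
  rw [replicaMean_const_mul, h.replicaMean_sum fun e _ => hsum e]
  calc 2 * ∑ e : (Fin 3 × Fin 3 × κ) × (Fin 3 × Fin 3 × κ) with e.1 ≠ e.2,
        replicaMean μ U _ β (fun X => w (0, a) (0, b) X + w e.1 e.2 X)
      ≤ 2 * ∑ e : (Fin 3 × Fin 3 × κ) × (Fin 3 × Fin 3 × κ) with e.1 ≠ e.2, (o + o) := by
        gcongr with e he
        rw [h.replicaMean_add (hw _ _) (hw _ _)]
        exact add_le_add (ho hne) (ho (Finset.mem_filter.1 he).2)
    _ ≤ 2 * (9 * Fintype.card (Fin 3 × κ) ^ 2 * (o + o)) := by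
        rw [Finset.sum_const, nsmul_eq_mul]
        gcongr
        exact card_distinct_pairs_le _
    _ = 324 * Fintype.card κ ^ 2 * o := by
        rw [Fintype.card_prod, Fintype.card_fin]
        push_cast
        ring

lemma abs_overlapSlope_le (h : IsGaussianField μ U K) (hK0 : ∀ x y, 0 ≤ K x y)
    (hKv : ∀ x, K x x = v) (hQm : Measurable Q) (hQ : Integrable Q (Measure.pi P)) (hr : 0 ≤ r)
    (β : ℝ) :
    |overlapSlope μ U K P r Q β| ≤
      2916 * Fintype.card κ ^ 4 * overlapSum μ U K P (r + 1) (fun X => |Q X|) β := by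
  have ho0 : 0 ≤ overlapSum μ U K P (r + 1) (fun X => |Q X|) β :=
    overlapSum_nonneg hK0 (fun _ => abs_nonneg _) (r + 1) β
  refine (Finset.abs_sum_le_sum_abs _ _).trans ((Finset.sum_le_sum fun e he =>
    h.abs_replicaMean_mul_replicaGap_le hK0 hKv hQm hQ hr β (Finset.mem_filter.1 he).2).trans ?_)
  rw [Finset.sum_const, nsmul_eq_mul]
  refine (mul_le_mul_of_nonneg_right (card_distinct_pairs_le κ) (by positivity)).trans_eq ?_
  ring

end IsGaussianField

end OverlapDerivative

section Torus

variable {ρ : Mollifier} {ε : ℝ} {t : ℝ≥0}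

lemma rep_mem (z : Torus) (i : Fin 2) : rep z i ∈ Ico (-1 / 2 : ℝ) (1 / 2) :=
  have hz := (AddCircle.equivIco (1 : ℝ) (-1 / 2) (z i)).2
  ⟨hz.1, hz.2.trans_eq (by norm_num)⟩

lemma coe_rep (z : Torus) (i : Fin 2) : ((rep z i : ℝ) : UnitAddCircle) = z i :=
  (AddCircle.equivIco (1 : ℝ) (-1 / 2)).symm_apply_apply (z i)

lemma rep_eq_of_coe_eq {z : Torus} {i : Fin 2} {x : ℝ} (hx : x ∈ Ico (-1 / 2 : ℝ) (1 / 2))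
    (h : (x : UnitAddCircle) = z i) : rep z i = x := by
  have hx' : x ∈ Ico (-1 / 2 : ℝ) (-1 / 2 + 1) := by
    rwa [show (-1 / 2 + 1 : ℝ) = 1 / 2 by norm_num]
  rw [rep, ← h, AddCircle.equivIco_coe_eq hx']

lemma mollTorus_nonneg (ρ : Mollifier) (ε : ℝ) (z : Torus) : 0 ≤ mollTorus ρ ε z :=
  mul_nonneg (by positivity) (ρ.nonneg _)

lemma mollTorus_eq_zero (h0 : 0 < ε) {z : Torus} {i : Fin 2} (h : ε / 2 ≤ |rep z i|) :
    mollTorus ρ ε z = 0 := by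
  suffices hρ : ε⁻¹ • rep z ∉ tsupport ρ.toFun by
    rw [mollTorus, image_eq_zero_of_notMem_tsupport hρ, mul_zero]
  intro hmem
  have hsupp := ρ.support_subset hmem i
  simp only [Pi.smul_apply, smul_eq_mul] at hsupp
  have habs : |ε⁻¹ * rep z i| < 1 / 2 := abs_lt.2 ⟨by linarith [hsupp.1], hsupp.2⟩
  rw [abs_mul, abs_of_pos (inv_pos.2 h0), inv_mul_lt_iff₀ h0] at habs
  linarith

lemma rep_neg {z : Torus} {i : Fin 2} (h : rep z i ≠ -1 / 2) : rep (-z) i = -rep z i := by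
  have hz := rep_mem z i
  refine rep_eq_of_coe_eq ⟨by linarith [hz.2], ?_⟩ ?_
  · linarith [lt_of_le_of_ne hz.1 h.symm]
  · rw [AddCircle.coe_neg, coe_rep]
    rfl

lemma rep_neg_of_eq {z : Torus} {i : Fin 2} (h : rep z i = -1 / 2) : rep (-z) i = -1 / 2 := by
  refine rep_eq_of_coe_eq ⟨le_rfl, by norm_num⟩ ?_
  rw [Pi.neg_apply, ← coe_rep z i, h, ← AddCircle.coe_neg,
    ← AddCircle.coe_add_period (1 : ℝ) (-1 / 2)]
  norm_num

lemma mollTorus_neg (h0 : 0 < ε) (h1 : ε < 1) (z : Torus) :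
    mollTorus ρ ε (-z) = mollTorus ρ ε z := by
  by_cases h : ∃ i, rep z i = -1 / 2
  · obtain ⟨i, hi⟩ := h
    have hhalf : ε / 2 ≤ |(-1 / 2 : ℝ)| := by norm_num [abs_of_neg]; linarith
    rw [mollTorus_eq_zero (z := z) h0 (by rwa [hi]),
      mollTorus_eq_zero (z := -z) h0 (by rwa [rep_neg_of_eq hi])]
  · push Not at h
    have hneg : rep (-z) = -rep z := funext fun i => rep_neg (h i)
    rw [mollTorus, hneg, smul_neg, ρ.even, mollTorus]

lemma norm_le_abs_rep (z : Torus) (i : Fin 2) : ‖z i‖ ≤ |rep z i| := by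
  conv_lhs => rw [← coe_rep z i]
  exact QuotientAddGroup.norm_mk_le_norm

lemma norm_apply_of_rep_eq {z : Torus} {i : Fin 2} (h : rep z i = -1 / 2) : ‖z i‖ = 1 / 2 := by
  have hhalf := AddCircle.norm_half_period_eq (1 : ℝ)
  rw [← coe_rep z i, h, neg_div, AddCircle.coe_neg, norm_neg, hhalf, abs_one]

lemma continuousAt_rep {z : Torus} (h : ∀ i, rep z i ≠ -1 / 2) : ContinuousAt rep z := by
  refine continuousAt_pi.2 fun i => ?_
  have hne : z i ≠ ((-1 / 2 : ℝ) : UnitAddCircle) := fun hi =>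
    h i (rep_eq_of_coe_eq ⟨le_rfl, by norm_num⟩ hi.symm)
  have hIco := AddCircle.continuousAt_equivIco (1 : ℝ) (-1 / 2) hne
  exact (continuous_subtype_val.continuousAt.comp hIco).comp (f := fun w : Torus => w i)
    (continuous_apply i).continuousAt

lemma mollTorus_eventuallyEq_zero (h0 : 0 < ε) (h1 : ε < 1) {z : Torus} {i : Fin 2}
    (h : rep z i = -1 / 2) : mollTorus ρ ε =ᶠ[nhds z] fun _ => 0 := by
  have hfar : ∀ᶠ w : Torus in nhds z, ε / 2 < ‖w i‖ :=
    (continuous_norm.comp (continuous_apply i)).continuousAt.eventually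
      (lt_mem_nhds (by simp only [Function.comp_apply, norm_apply_of_rep_eq h]; linarith))
  exact hfar.mono fun w hw => mollTorus_eq_zero h0 (hw.le.trans (norm_le_abs_rep w i))

lemma continuous_mollTorus (h0 : 0 < ε) (h1 : ε < 1) : Continuous (mollTorus ρ ε) := by
  refine continuous_iff_continuousAt.2 fun z => ?_
  by_cases h : ∃ i, rep z i = -1 / 2
  · obtain ⟨i, hi⟩ := h
    exact continuousAt_const.congr (mollTorus_eventuallyEq_zero h0 h1 hi).symm
  · push Not at h
    exact (ρ.smooth.continuous.continuousAt.comp ((continuousAt_rep h).const_smul ε⁻¹)).const_mul _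

lemma continuous_integrand (h0 : 0 < ε) (h1 : ε < 1) :
    Continuous (integrand ρ ε : Path t → NoiseSpace t) := by
  have hc := continuous_mollTorus (ρ := ρ) h0 h1
  let g : Path t → C(Icc (0 : ℝ) t × Torus, ℝ) := fun X =>
    ⟨fun p => mollTorus ρ ε (X p.1 - p.2), by fun_prop⟩
  have hg : Continuous g := by
    refine ContinuousMap.continuous_of_continuous_uncurry _ ?_
    refine hc.comp ?_
    fun_prop
  have heq : (integrand ρ ε : Path t → NoiseSpace t) = fun X =>
      ContinuousMap.toLp 2 ((timeMeasure t).prod (volume : Measure Torus)) ℝ (g X) := by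
    funext X
    refine Lp.ext ?_
    filter_upwards [(memLp_integrand ρ ε X).coeFn_toLp,
      ContinuousMap.coeFn_toLp (p := 2) (𝕜 := ℝ) ((timeMeasure t).prod (volume : Measure Torus))
        (g X)] with p hp1 hp2
    rw [integrand, hp1, hp2]
    rfl
  rw [heq]
  exact (ContinuousLinearMap.continuous _).comp hg

lemma R_nonneg (ρ : Mollifier) (ε : ℝ) (z : Torus) : 0 ≤ R ρ ε z :=
  integral_nonneg fun _ => mul_nonneg (mollTorus_nonneg _ _ _) (mollTorus_nonneg _ _ _)

lemma integral_mollTorus_mul (h0 : 0 < ε) (h1 : ε < 1) (x x' : Torus) :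
    ∫ y : Torus, mollTorus ρ ε (x - y) * mollTorus ρ ε (x' - y) = R ρ ε (x - x') := by
  rw [R, ← integral_sub_right_eq_self
    (fun y : Torus => mollTorus ρ ε y * mollTorus ρ ε (x - x' - y)) x']
  refine integral_congr_ae (.of_forall fun y => ?_)
  simp only
  rw [← mollTorus_neg h0 h1 (x' - y), neg_sub, mul_comm]
  congr 2
  abel

lemma inner_integrand (h0 : 0 < ε) (h1 : ε < 1) (X Y : Path t) :
    inner ℝ (integrand ρ ε X) (integrand ρ ε Y) = intersectionTime ρ ε X Y := by
  have hae : (fun p => inner ℝ ((integrand ρ ε X : NoiseSpace t) p) (integrand ρ ε Y p))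
      =ᵐ[(timeMeasure t).prod volume]
        fun p => mollTorus ρ ε (X p.1 - p.2) * mollTorus ρ ε (Y p.1 - p.2) := by
    filter_upwards [(memLp_integrand ρ ε X).coeFn_toLp, (memLp_integrand ρ ε Y).coeFn_toLp]
      with p hX hY
    rw [integrand, integrand, hX, hY]
    exact mul_comm _ _
  have hint : Integrable (fun p : Icc (0 : ℝ) t × Torus =>
      mollTorus ρ ε (X p.1 - p.2) * mollTorus ρ ε (Y p.1 - p.2)) ((timeMeasure t).prod volume) :=
    (memLp_integrand ρ ε X).integrable_mul (memLp_integrand ρ ε Y)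
  rw [L2.inner_def, integral_congr_ae hae, integral_prod _ hint, intersectionTime]
  simp only [integral_mollTorus_mul h0 h1]

lemma intersectionTime_nonneg (ρ : Mollifier) (ε : ℝ) (X Y : Path t) :
    0 ≤ intersectionTime ρ ε X Y :=
  integral_nonneg fun _ => R_nonneg _ _ _

lemma intersectionTime_self (ρ : Mollifier) (ε : ℝ) (X : Path t) :
    intersectionTime ρ ε X X = intersectionTime ρ ε (0 : Path t) 0 := by
  simp only [intersectionTime, sub_self]

lemma IsWhiteNoise.isGaussianField_integrand {Ω : Type*} [MeasurableSpace Ω] {μ : Measure Ω}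
    {W : NoiseSpace t → Ω → ℝ} (hW : IsWhiteNoise μ W) (h0 : 0 < ε) (h1 : ε < 1) :
    IsGaussianField μ (fun (X : Path t) ω => W (integrand ρ ε X) ω) (intersectionTime ρ ε) where
  measurable := hW.measurable.comp
    (f := fun p : Path t × Ω => (integrand ρ ε p.1, p.2))
    (((continuous_integrand h0 h1).measurable.comp measurable_fst).prodMk measurable_snd)
  gaussian := hW.gaussian.comp_right (integrand ρ ε)
  mean X := hW.mean _
  covariance X Y := by rw [hW.covariance, inner_integrand h0 h1]
  bounded := ⟨_, fun X => (intersectionTime_self ρ ε X).le⟩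

end Torus

lemma hasDerivWithinAt_comp_sqrt {f D : ℝ → ℝ} (hD : Continuous D)
    (hf : ∀ β, HasDerivAt f (β * D β) β) {L : ℝ} (hL : 0 < L) {θ : ℝ} (hθ : 0 ≤ θ) :
    HasDerivWithinAt (fun θ => f (Real.sqrt θ / Real.sqrt L))
      (D (Real.sqrt θ / Real.sqrt L) / (2 * L)) (Ici 0) θ := by
  have hfc : Continuous f := continuous_iff_continuousAt.2 fun β => (hf β).continuousAt
  have hsqrt : Continuous fun θ => Real.sqrt θ / Real.sqrt L := Real.continuous_sqrt.div_const _
  have hpos : ∀ x, 0 < x → HasDerivAt (fun θ => f (Real.sqrt θ / Real.sqrt L))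
      (D (Real.sqrt x / Real.sqrt L) / (2 * L)) x := fun x hx => by
    refine ((hf _).comp x ((Real.hasDerivAt_sqrt hx.ne').div_const _)).congr_deriv ?_
    have hx0 : Real.sqrt x ≠ 0 := (Real.sqrt_pos.2 hx).ne'
    have hL0 : Real.sqrt L ≠ 0 := (Real.sqrt_pos.2 hL).ne'
    nth_rewrite 5 [← Real.mul_self_sqrt hL.le]
    field_simp
  rcases hθ.eq_or_lt with rfl | hθ'
  · refine hasDerivWithinAt_Ici_of_tendsto_deriv (s := Ioi 0)
      (fun x hx => (hpos x hx).differentiableAt.differentiableWithinAt)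
      (hfc.comp hsqrt).continuousWithinAt self_mem_nhdsWithin ?_
    exact ((hD.comp hsqrt).div_const _).continuousWithinAt.congr'
      (Filter.eventually_of_mem self_mem_nhdsWithin fun x hx => (hpos x hx).deriv.symm)
  · exact (hpos θ hθ').hasDerivWithinAt

section Hierarchy

variable {g g' : ℕ → ℝ → ℝ} {C A b T : ℝ}

lemma hasDerivAt_mul_pow_div_factorial (C : ℝ) (n : ℕ) (x : ℝ) :
    HasDerivAt (fun x => (C * x) ^ (n + 1) / ((n + 1).factorial : ℝ))
      (C * ((C * x) ^ n / (n.factorial : ℝ))) x := by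
  refine ((((hasDerivAt_id x).const_mul C).pow (n + 1)).div_const _).congr_deriv ?_
  have hn : (n.factorial : ℝ) ≠ 0 := by exact_mod_cast n.factorial_ne_zero
  rw [Nat.factorial_succ]
  push_cast
  simp only [id_eq]
  field_simp

lemma hasDerivAt_expPartialSum (a : ℕ → ℝ) (C : ℝ) (n : ℕ) (x : ℝ) :
    HasDerivAt (fun x => ∑ j ∈ Finset.range (n + 1), (C * x) ^ j / (j.factorial : ℝ) * a j)
      (C * ∑ j ∈ Finset.range n, (C * x) ^ j / (j.factorial : ℝ) * a (j + 1)) x := by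
  simp only [Finset.sum_range_succ', pow_zero, Nat.factorial_zero]
  refine ((HasDerivAt.fun_sum fun j _ =>
    (hasDerivAt_mul_pow_div_factorial C j x).mul_const (a (j + 1))).add_const _).congr_deriv ?_
  simp only [Finset.mul_sum, mul_assoc]

lemma le_expPartialSum_of_hierarchy (hC : 0 ≤ C)
    (hd : ∀ m, ∀ θ ∈ Icc 0 T, HasDerivWithinAt (g m) (g' m θ) (Ici 0) θ)
    (hg' : ∀ m, ∀ θ ∈ Icc 0 T, g' m θ ≤ C * g (m + 1) θ)
    (hA : ∀ m, ∀ θ ∈ Icc 0 T, g m θ ≤ A * b ^ m) (n m : ℕ) {θ : ℝ} (hθ : θ ∈ Icc 0 T) :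
    g m θ ≤ ∑ j ∈ Finset.range n, (C * θ) ^ j / (j.factorial : ℝ) * g (m + j) 0 +
      (C * θ) ^ n / (n.factorial : ℝ) * (A * b ^ (m + n)) := by
  induction n generalizing m θ with
  | zero => simpa using hA m θ hθ
  | succ n ih =>
    have hbound : ∀ x, HasDerivAt (fun x =>
        ∑ j ∈ Finset.range (n + 1), (C * x) ^ j / (j.factorial : ℝ) * g (m + j) 0 +
          (C * x) ^ (n + 1) / ((n + 1).factorial : ℝ) * (A * b ^ (m + (n + 1))))
        (C * (∑ j ∈ Finset.range n, (C * x) ^ j / (j.factorial : ℝ) * g (m + 1 + j) 0 +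
          (C * x) ^ n / (n.factorial : ℝ) * (A * b ^ (m + 1 + n)))) x := fun x => by
      refine ((hasDerivAt_expPartialSum (fun j => g (m + j) 0) C n x).add
        ((hasDerivAt_mul_pow_div_factorial C n x).mul_const _)).congr_deriv ?_
      simp only [mul_add, mul_assoc, add_assoc, add_comm 1]
    have hmem : ∀ {x}, x ∈ Ico 0 θ → x ∈ Icc 0 T := fun hx => ⟨hx.1, hx.2.le.trans hθ.2⟩
    refine image_le_of_deriv_right_le_deriv_boundary (f := g m) (f' := g' m) (a := 0) (b := θ)
      (fun x hx => ((hd m x ⟨hx.1, hx.2.trans hθ.2⟩).continuousWithinAt).mono Icc_subset_Ici_self)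
      (fun x hx => (hd m x (hmem hx)).mono (Ici_subset_Ici.2 hx.1)) ?_
      (fun x _ => (hbound x).continuousAt.continuousWithinAt)
      (fun x _ => (hbound x).hasDerivWithinAt) (fun x hx => ?_) ⟨hθ.1, le_rfl⟩
    · simp [Finset.sum_range_succ']
    · exact (hg' m x (hmem hx)).trans (mul_le_mul_of_nonneg_left (ih (m + 1) (hmem hx)) hC)

lemma summable_and_le_tsum_of_hierarchy (hC : 0 ≤ C)
    (hd : ∀ m, ∀ θ ∈ Icc 0 T, HasDerivWithinAt (g m) (g' m θ) (Ici 0) θ)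
    (hg' : ∀ m, ∀ θ ∈ Icc 0 T, g' m θ ≤ C * g (m + 1) θ) (hg0 : ∀ m, 0 ≤ g m 0)
    (hA : ∀ m, ∀ θ ∈ Icc 0 T, g m θ ≤ A * b ^ m) (hT : 0 ≤ T) :
    Summable (fun j : ℕ => (C * T) ^ j / (j.factorial : ℝ) * g j 0) ∧
      g 0 T ≤ ∑' j : ℕ, (C * T) ^ j / (j.factorial : ℝ) * g j 0 := by
  have hpow : ∀ j : ℕ, (C * T) ^ j / (j.factorial : ℝ) * (A * b ^ j) =
      A * ((C * T * b) ^ j / (j.factorial : ℝ)) := fun j => by rw [mul_pow (C * T) b]; ring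
  have hmajorant : Summable fun j : ℕ => A * ((C * T * b) ^ j / (j.factorial : ℝ)) :=
    (Real.summable_pow_div_factorial _).mul_left _
  have hcoeff : ∀ j : ℕ, 0 ≤ (C * T) ^ j / (j.factorial : ℝ) := fun j => by positivity
  have hterm : ∀ j : ℕ, 0 ≤ (C * T) ^ j / (j.factorial : ℝ) * g j 0 := fun j =>
    mul_nonneg (hcoeff j) (hg0 j)
  have hsum : Summable (fun j : ℕ => (C * T) ^ j / (j.factorial : ℝ) * g j 0) :=
    hmajorant.of_nonneg_of_le hterm fun j => (hpow j).subst
      (mul_le_mul_of_nonneg_left (hA j 0 ⟨le_rfl, hT⟩) (hcoeff j))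
  refine ⟨hsum, ?_⟩
  have hlim := (tendsto_const_nhds (x := ∑' j : ℕ, (C * T) ^ j / (j.factorial : ℝ) * g j 0)
    (f := Filter.atTop)).add hmajorant.tendsto_atTop_zero
  rw [add_zero] at hlim
  refine ge_of_tendsto' hlim fun n => ?_
  have hle := le_expPartialSum_of_hierarchy hC hd hg' hA n 0 (right_mem_Icc.2 hT)
  simp only [zero_add, hpow] at hle
  exact hle.trans (add_le_add (hsum.sum_le_tsum _ fun j _ => hterm j) le_rfl)

end Hierarchy

lemma tilted_sub_const {S : Type*} [MeasurableSpace S] (P : Measure S) (f : S → ℝ) (c : ℝ) :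
    (P.tilted fun x => f x - c) = P.tilted f := by
  simp only [Measure.tilted, Real.exp_sub, integral_div]
  congr 1
  funext x
  rw [div_div_div_cancel_right₀ (Real.exp_ne_zero c)]

section WhiteNoise

variable {Ω : Type*} [MeasurableSpace Ω] {μ : Measure Ω} {ρ : Mollifier}
  {ε : ℝ} {t : ℝ≥0} {W : NoiseSpace t → Ω → ℝ} {J : ℕ} {P : Fin J → Measure (Path t)}
  {Q : (Fin J → Path t) → ℝ} {r : ℝ}

lemma G_eq_overlapSum (r : ℝ) (Q : (Fin J → Path t) → ℝ) (θ : ℝ) :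
    G μ W ρ ε P r Q θ = |Real.log ε| ^ (-r) *
      overlapSum μ (fun X ω => W (integrand ρ ε X) ω) (intersectionTime ρ ε) P r Q
        (Real.sqrt θ / Real.sqrt |Real.log ε|) := by
  simp only [G, F, Fterm, tiltedLaw, tilted_sub_const, energy, overlapSum, Finset.sum_filter,
    Fintype.sum_prod_type]
  congr 1
  refine Finset.sum_congr rfl fun α _ => ?_
  rw [Finset.sum_comm]
  rfl

lemma G_nonneg (hQ0 : ∀ X, 0 ≤ Q X) (r θ : ℝ) : 0 ≤ G μ W ρ ε P r Q θ := by
  rw [G_eq_overlapSum]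
  exact mul_nonneg (Real.rpow_nonneg (abs_nonneg _) _)
    (overlapSum_nonneg (intersectionTime_nonneg ρ ε) hQ0 r _)

variable [IsProbabilityMeasure μ] [∀ j, IsProbabilityMeasure (P j)]

namespace IsWhiteNoise

variable (hW : IsWhiteNoise μ W) (h0 : 0 < ε) (h1 : ε < 1)
include hW h0 h1

lemma G_le_abs (hQi : Integrable Q (Measure.pi P)) (hr : 0 ≤ r) (θ : ℝ) :
    G μ W ρ ε P r Q θ ≤ G μ W ρ ε P r (fun X => |Q X|) θ := by
  simp only [G_eq_overlapSum]
  exact mul_le_mul_of_nonneg_left ((hW.isGaussianField_integrand h0 h1).overlapSum_le_abs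
    (intersectionTime_nonneg ρ ε) hQi hr _) (Real.rpow_nonneg (abs_nonneg _) _)

lemma exists_G_le_mul_rpow (hQ : Measurable Q) (hQi : Integrable Q (Measure.pi P))
    (hQ0 : ∀ X, 0 ≤ Q X) (T : ℝ) :
    ∃ A b : ℝ, 0 ≤ b ∧ ∀ r, 0 ≤ r → ∀ θ ∈ Icc 0 T, G μ W ρ ε P r Q θ ≤ A * b ^ r := by
  have h := hW.isGaussianField_integrand (ρ := ρ) h0 h1
  have hmean : Continuous fun θ => replicaMean μ (fun (X : Path t) ω => W (integrand ρ ε X) ω) P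
      (Real.sqrt θ / Real.sqrt |Real.log ε|) Q :=
    (h.continuous_replicaMean hQ hQi).comp (Real.continuous_sqrt.div_const _)
  obtain ⟨M, hM⟩ := (isCompact_Icc (a := 0) (b := T)).bddAbove_image hmean.continuousOn
  let v := (intersectionTime ρ ε (0 : Path t) 0).toNNReal
  refine ⟨9 * J ^ 2 * M, v / |Real.log ε|, by positivity, fun r hr θ hθ => ?_⟩
  have hsum := h.overlapSum_le (v := v) (intersectionTime_nonneg ρ ε)
    (fun X => (intersectionTime_self ρ ε X).trans_le (Real.le_coe_toNNReal _)) hQ hQi hQ0 hr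
    (Real.sqrt θ / Real.sqrt |Real.log ε|)
  rw [Fintype.card_fin] at hsum
  rw [G_eq_overlapSum]
  calc _ ≤ |Real.log ε| ^ (-r) * (9 * J ^ 2 * M * v ^ r) := by
        gcongr
        refine hsum.trans ?_
        gcongr
        exact hM (mem_image_of_mem _ hθ)
    _ = 9 * J ^ 2 * M * (v / |Real.log ε|) ^ r := by
        rw [Real.div_rpow v.coe_nonneg (abs_nonneg _), Real.rpow_neg (abs_nonneg _)]
        ring

lemma hasDerivWithinAt_G (hQ : Measurable Q) (hQi : Integrable Q (Measure.pi P)) (hr : 0 ≤ r)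
    {θ : ℝ} (hθ : 0 ≤ θ) :
    HasDerivWithinAt (G μ W ρ ε P r Q)
      (|Real.log ε| ^ (-r) * (overlapSlope μ (fun X ω => W (integrand ρ ε X) ω)
        (intersectionTime ρ ε) P r Q (Real.sqrt θ / Real.sqrt |Real.log ε|) /
          (2 * |Real.log ε|))) (Ici 0) θ := by
  have h := hW.isGaussianField_integrand (ρ := ρ) h0 h1
  have hK0 := intersectionTime_nonneg (t := t) ρ ε
  rw [funext (G_eq_overlapSum (μ := μ) (W := W) (ρ := ρ) (ε := ε) (P := P) r Q)]
  exact (hasDerivWithinAt_comp_sqrt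
    (h.continuous_overlapSlope hK0 (intersectionTime_self ρ ε) hQ hQi hr)
    (h.hasDerivAt_overlapSum hK0 hQ hQi hr)
    (abs_pos.2 (Real.log_neg h0 h1).ne) hθ).const_mul _

lemma abs_derivWithin_G_le (hQ : Measurable Q) (hQi : Integrable Q (Measure.pi P)) (hr : 0 ≤ r)
    {θ : ℝ} (hθ : 0 ≤ θ) :
    |derivWithin (G μ W ρ ε P r Q) (Ici 0) θ| ≤
      1458 * J ^ 4 * G μ W ρ ε P (r + 1) (fun X => |Q X|) θ := by
  have hL : 0 < |Real.log ε| := abs_pos.2 (Real.log_neg h0 h1).ne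
  have hslope := (hW.isGaussianField_integrand (ρ := ρ) h0 h1).abs_overlapSlope_le
    (intersectionTime_nonneg ρ ε) (intersectionTime_self ρ ε) hQ hQi hr
    (Real.sqrt θ / Real.sqrt |Real.log ε|)
  rw [Fintype.card_fin] at hslope
  rw [(hW.hasDerivWithinAt_G h0 h1 hQ hQi hr hθ).derivWithin (uniqueDiffOn_Ici 0 θ hθ),
    abs_mul, abs_div, abs_of_pos (Real.rpow_pos_of_pos hL _), abs_of_pos (mul_pos two_pos hL)]
  refine (mul_le_mul_of_nonneg_left (div_le_div_of_nonneg_right hslope (by positivity))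
    (by positivity)).trans_eq ?_
  rw [G_eq_overlapSum, neg_add, ← sub_eq_add_neg, Real.rpow_sub_one hL.ne']
  ring

lemma summable_and_G_le_tsum (hQ : Measurable Q) (hQi : Integrable Q (Measure.pi P))
    (hr : 0 ≤ r) {C : ℝ} (hC : 1458 * J ^ 4 ≤ C) {θ : ℝ} (hθ : 0 ≤ θ) :
    Summable (fun j : ℕ =>
        (C * θ) ^ j / (j.factorial : ℝ) * G μ W ρ ε P (r + j) (fun X => |Q X|) 0) ∧
      G μ W ρ ε P r Q θ ≤ ∑' j : ℕ,
        (C * θ) ^ j / (j.factorial : ℝ) * G μ W ρ ε P (r + j) (fun X => |Q X|) 0 := by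
  have hrm : ∀ m : ℕ, 0 ≤ r + m := fun m => by positivity
  have hG0 : ∀ s x, 0 ≤ G μ W ρ ε P s (fun X => |Q X|) x := G_nonneg fun X => abs_nonneg (Q X)
  obtain ⟨A, b, hb, hA⟩ :=
    hW.exists_G_le_mul_rpow (ρ := ρ) h0 h1 hQ.abs hQi.abs (fun X => abs_nonneg (Q X)) θ
  have hseries := summable_and_le_tsum_of_hierarchy (C := C) (A := A * b ^ r) (b := b) (T := θ)
    (g := fun m => G μ W ρ ε P (r + m) fun X => |Q X|)
    (g' := fun m => derivWithin (G μ W ρ ε P (r + m) fun X => |Q X|) (Ici 0))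
    ((by positivity : (0 : ℝ) ≤ 1458 * J ^ 4).trans hC)
    (fun m x hx => (hW.hasDerivWithinAt_G h0 h1 hQ.abs hQi.abs (hrm m)
      hx.1).differentiableWithinAt.hasDerivWithinAt) (fun m x hx => ?_) (fun m => hG0 _ _)
    (fun m x hx => ?_) hθ
  · simp only [Nat.cast_zero, add_zero] at hseries
    exact ⟨hseries.1, (hW.G_le_abs h0 h1 hQi hr θ).trans hseries.2⟩
  · have hderiv := hW.abs_derivWithin_G_le (ρ := ρ) h0 h1 hQ.abs hQi.abs (hrm m) hx.1
    simp only [abs_abs, add_assoc, ← Nat.cast_add_one] at hderiv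
    exact (le_abs_self _).trans (hderiv.trans (mul_le_mul_of_nonneg_right hC (hG0 _ _)))
  · rw [mul_assoc, ← Real.rpow_natCast, ← Real.rpow_add_of_nonneg hb hr m.cast_nonneg]
    exact hA _ (hrm m) x hx

end IsWhiteNoise

end WhiteNoise

end KPZ

end

theorem proposition6p1_general (J : ℕ) :
    ∃ C : ℝ, 0 < C ∧
      ∀ {Ω : Type*} [MeasurableSpace Ω] (μ : Measure Ω) [IsProbabilityMeasure μ]
        (ρ : KPZ.Mollifier) (ε : ℝ) (_ : 0 < ε) (_ : ε < 1) (t : ℝ≥0)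
        (W : KPZ.NoiseSpace t → Ω → ℝ) (_ : KPZ.IsWhiteNoise μ W)
        (P : Fin J → Measure (KPZ.Path t)) [∀ j, IsProbabilityMeasure (P j)]
        (Q : (Fin J → KPZ.Path t) → ℝ) (_ : Measurable Q) (_ : Integrable Q (Measure.pi P))
        (r : ℝ) (_ : 0 ≤ r) (θ : ℝ) (_ : 0 ≤ θ),
        (DifferentiableWithinAt ℝ (KPZ.G μ W ρ ε P r Q) (Ici 0) θ ∧
          |derivWithin (KPZ.G μ W ρ ε P r Q) (Ici 0) θ| ≤
            C * KPZ.G μ W ρ ε P (r + 1) (fun X => |Q X|) θ) ∧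
        Summable (fun j : ℕ =>
          (C * θ) ^ j / (j.factorial : ℝ) * KPZ.G μ W ρ ε P (r + j) (fun X => |Q X|) 0) ∧
        KPZ.G μ W ρ ε P r Q θ ≤
          ∑' j : ℕ,
            (C * θ) ^ j / (j.factorial : ℝ) * KPZ.G μ W ρ ε P (r + j) (fun X => |Q X|) 0 := by
  have hC : 1458 * (J : ℝ) ^ 4 ≤ 1458 * J ^ 4 + 1 := by linarith
  refine ⟨1458 * J ^ 4 + 1, by positivity, ?_⟩
  intro Ω _ μ _ ρ ε h0 h1 t W hW P _ Q hQ hQi r hr θ hθ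
  refine ⟨⟨(hW.hasDerivWithinAt_G h0 h1 hQ hQi hr hθ).differentiableWithinAt, ?_⟩,
    hW.summable_and_G_le_tsum h0 h1 hQ hQi hr hC hθ⟩
  exact (hW.abs_derivWithin_G_le h0 h1 hQ hQi hr hθ).trans
    (mul_le_mul_of_nonneg_right hC (KPZ.G_nonneg (fun X => abs_nonneg (Q X)) _ _))

theorem proposition6p1 (J : ℕ) :
    ∃ C : ℝ, 0 < C ∧
      ∀ {Ω : Type*} [MeasurableSpace Ω] (μ : Measure Ω) [IsProbabilityMeasure μ]
        (ρ : KPZ.Mollifier) (ε : ℝ) (_ : 0 < ε) (_ : ε < 1) (t : ℝ≥0)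
        (W : KPZ.NoiseSpace t → Ω → ℝ) (_ : KPZ.IsWhiteNoise μ W)
        (x : Fin J → KPZ.Torus) (P : Fin J → Measure (KPZ.Path t))
        (_ : ∀ j, KPZ.IsBackwardBrownianLaw t (x j) (P j))
        (Q : (Fin J → KPZ.Path t) → ℝ) (_ : Measurable Q) (r : ℝ) (_ : 0 ≤ r)
        (θ : ℝ) (_ : 0 ≤ θ),
        (Integrable Q (Measure.pi P) →
          DifferentiableWithinAt ℝ (KPZ.G μ W ρ ε P r Q) (Ici 0) θ ∧
          |derivWithin (KPZ.G μ W ρ ε P r Q) (Ici 0) θ| ≤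
            C * KPZ.G μ W ρ ε P (r + 1) (fun X => |Q X|) θ) ∧
        ((∃ M : ℝ, ∀ X, |Q X| ≤ M) →
          Summable (fun j : ℕ =>
            (C * θ) ^ j / (j.factorial : ℝ) * KPZ.G μ W ρ ε P (r + j) (fun X => |Q X|) 0) ∧
          KPZ.G μ W ρ ε P r Q θ ≤
            ∑' j : ℕ,
              (C * θ) ^ j / (j.factorial : ℝ) * KPZ.G μ W ρ ε P (r + j) (fun X => |Q X|) 0) := by
  obtain ⟨C, hC, h⟩ := proposition6p1_general J
  refine ⟨C, hC, fun μ _ ρ ε h0 h1 t W hW x P hP Q hQ r hr θ hθ => ?_⟩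
  have hprob : ∀ j, IsProbabilityMeasure (P j) := fun j => (hP j).isProbabilityMeasure
  have hmain := fun hQi => h μ ρ ε h0 h1 t W hW P Q hQ hQi r hr θ hθ
  exact ⟨fun hQi => (hmain hQi).1, fun ⟨M, hM⟩ =>
    (hmain (.of_bound hQ.aestronglyMeasurable M (.of_forall hM))).2⟩
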